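/- Let $q$ be a real number with $0<|q|<1$ and let $d\ge 1$ and $j,k\ge 0$ be integers. For $N\ge\max(j,k)$ write $(N^d,j)$ for the partition with $d$ parts equal to $N$ followed by one part equal to $j$, and let $$s_{(N^d,j)/(k)}(1,q,q^2,\dots)=\sum_T\prod_{c}q^{T(c)}$$ be the principal specialization of the skew Schur function in infinitely many variables, where $T$ runs over the semistandard tableaux of skew shape $(N^d,j)/(k)$ with entries in $\{0,1,2,\dots\}$ and $c$ over the cells of the shape. For integers $n\ge 0$ put $(q;q)_n=\prod_{i=1}^n(1-q^i)$, $(q;q)_\infty=\prod_{i=1}^\infty(1-q^i)$, $\Gamma_q(n+1)=(q;q)_n/(1-q)^n$, $G_q(n+1)=\prod_{i=1}^{n-1}\Gamma_q(i+1)$ (empty products are $1$), and for $0\le m\le n$ put $\binom{n}{m}_q=\frac{\Gamma_q(n+1)}{\Gamma_q(m+1)\Gamma_q(n-m+1)}$. (a) For every $N\ge\max(j,k)$ the sum defining $s_{(N^d,j)/(k)}(1,q,q^2,\dots)$ converges absolutely, and $$s_{(N^d,j)/(k)}(1,q,q^2,\dots)=\frac{q^{(d-1)j-dk+d(d-1)N/2}}{(1-q)^{d(N+1)}}\,\frac{G_q(N+2)\,G_q(d+1)}{G_q(d+N+2)}\,\frac{(q;q)_{d+k}}{(q;q)_j}\sum_{r=\max(j,k)}^{N}q^r\binom{r}{r-k}_q\binom{d+r-j-1}{r-j}_q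 .$$ (b) Put $$A_N=q^{dj-(d-1)k+d(d-1)N/2}\,\frac{(1-q)^{d(d-1)/2}\,G_q(d+1)}{(q;q)_\infty^{d}},\qquad S=\sum_{r=0}^{\min(j,k)}q^{-r}\frac{1}{(q;q)_{j-r}}\binom{d+k-r-1}{k-r}_q .$$ With $d,j,k,q$ fixed and $N\to\infty$ we have $s_{(N^d,j)/(k)}(1,q,q^2,\dots)/A_N\to S$. In particular, if $0<q<1$, then $s_{(N^d,j)/(k)}(1,q,q^2,\dots)\sim A_N\,S$, that is, the quotient of the two sides tends to $1$. -/

import Mathlib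

open Filter Topology Asymptotics

noncomputable section

/-- A semistandard tableau of skew shape `lam / mu`, with entries in `ℕ`: a filling of the cells of
`lam` that are not in `mu`, weakly increasing along rows and strictly increasing down columns.
As for Mathlib's `SemistandardYoungTableau`, the filling is a function `ℕ → ℕ → ℕ` that vanishes
off the shape.  There is no such tableau unless `mu` is contained in `lam`. -/
@[ext]
structure SkewTableau (lam mu : YoungDiagram) where
  entry : ℕ → ℕ → ℕ
  contained : mu ≤ lam
  row_weak : ∀ {i c₁ c₂ : ℕ}, c₁ < c₂ → (i, c₁) ∉ mu → (i, c₂) ∈ lam →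
    entry i c₁ ≤ entry i c₂
  col_strict : ∀ {i₁ i₂ c : ℕ}, i₁ < i₂ → (i₁, c) ∉ mu → (i₂, c) ∈ lam →
    entry i₁ c < entry i₂ c
  zeros : ∀ {i c : ℕ}, (i, c) ∉ lam ∨ (i, c) ∈ mu → entry i c = 0

/-- The monomial `x^T`: the product of the variables indexed by the entries of `T`. -/
def SkewTableau.weight {lam mu : YoungDiagram} (x : ℕ → ℝ) (T : SkewTableau lam mu) : ℝ :=
  ∏ c ∈ lam.cells \ mu.cells, x (T.entry c.1 c.2)

/-- The skew Schur function `s_{lam/mu}(x 0, x 1, x 2, …)` in infinitely many variables, evaluated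
at real numbers: the sum of `x^T` over all semistandard tableaux `T` of shape `lam / mu`. -/
def skewSchur (lam mu : YoungDiagram) (x : ℕ → ℝ) : ℝ :=
  ∑' T : SkewTableau lam mu, T.weight x

/-- The diagram of the rectangular partition `(b^a)`: `a` rows of length `b`. -/
def rectDiagram (a b : ℕ) : YoungDiagram where
  cells := Finset.range a ×ˢ Finset.range b
  isLowerSet := by
    rintro ⟨i, c⟩ ⟨i', c'⟩ ⟨h₁, h₂⟩ h
    simp only [Finset.coe_product, Finset.coe_range, Set.mem_prod, Set.mem_Iio] at h ⊢
    exact ⟨lt_of_le_of_lt h₁ h.1, lt_of_le_of_lt h₂ h.2⟩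

/-- The diagram of the partition `(N, …, N, j)` with `d` parts equal to `N` followed by a part `j`,
where `j ≤ N` (see `rowLen_rectAddRow`). -/
def rectAddRow (d N j : ℕ) : YoungDiagram :=
  rectDiagram d N ⊔ rectDiagram (d + 1) j

/-- The diagram of the one-row partition `(k)`. -/
def oneRow (k : ℕ) : YoungDiagram := rectDiagram 1 k

theorem mem_rectDiagram {a b i c : ℕ} : (i, c) ∈ rectDiagram a b ↔ i < a ∧ c < b := by
  rw [← YoungDiagram.mem_cells]
  simp [rectDiagram]

theorem rowLen_rectAddRow {d N j : ℕ} (hj : j ≤ N) (i : ℕ) :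
    (rectAddRow d N j).rowLen i = if i < d then N else if i = d then j else 0 := by
  refine eq_of_forall_lt_iff fun c => ?_
  rw [← YoungDiagram.mem_iff_lt_rowLen, rectAddRow, YoungDiagram.mem_sup, mem_rectDiagram,
    mem_rectDiagram]
  split_ifs <;> omega

theorem rowLen_oneRow (k i : ℕ) : (oneRow k).rowLen i = if i = 0 then k else 0 := by
  refine eq_of_forall_lt_iff fun c => ?_
  rw [← YoungDiagram.mem_iff_lt_rowLen, oneRow, mem_rectDiagram]
  split_ifs <;> omega

/-- `(q;q)_n = ∏_{i=1}^{n} (1 - q^i)`. -/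
def qPoch (q : ℝ) (n : ℕ) : ℝ := ∏ i ∈ Finset.Icc 1 n, (1 - q ^ i)

/-- The Euler function `(q;q)_∞ = ∏_{i=1}^{∞} (1 - q^i)`. -/
def qPochInf (q : ℝ) : ℝ := ∏' i : ℕ, (1 - q ^ (i + 1))

/-- The `q`-Gamma function at natural arguments, `Γ_q(n+1) = (q;q)_n / (1-q)^n`
(at its pole `0` it is given the value `0`; this value is never used). -/
def qGamma (q : ℝ) : ℕ → ℝ
  | 0 => 0
  | n + 1 => qPoch q n / (1 - q) ^ n

/-- The `q`-Barnes function at natural arguments: `G_q(0) = 0` and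
`G_q(n+1) = ∏_{i=1}^{n-1} Γ_q(i+1)`. -/
def qBarnes (q : ℝ) : ℕ → ℝ
  | 0 => 0
  | n + 1 => ∏ i ∈ Finset.Ico 1 n, qGamma q (i + 1)

/-- The `q`-binomial coefficient
`[n choose m]_q = Γ_q(n+1) / (Γ_q(m+1) Γ_q(n-m+1))` for `m ≤ n`, and `0` for `m > n`. -/
def qBinom (q : ℝ) (n m : ℕ) : ℝ :=
  if m ≤ n then qGamma q (n + 1) / (qGamma q (m + 1) * qGamma q (n - m + 1)) else 0

end

/-!
By the dual Jacobi–Trudi formula, the generating function of the tableaux of a skew shape with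
column lengths `l` and `m` is the determinant of the elementary symmetric functions
`e_{l_b - m_a + a - b}`. It is proved by induction on the number of variables: removing the cells
with the smallest entry, at most one in each column, expands the determinant by multilinearity, and
the removals that do not leave a skew shape contribute a determinant with two equal rows. At the
variables `1, q, q², …` the shape `(N^d, j) / (k)` gives a minor of the Toeplitz matrix
`e_{d + b - a}(1, q, q², …)`. The `q`-Vandermonde identity factors this matrix into triangular and
diagonal matrices, and the `q`-binomial theorem inverts the factors; the minor is, up to sign, the
determinant times an entry of the inverse, and this entry is the sum over `r` in (a).

For (b), let `Σ(j, k)` be the sum over `r`. By the `q`-Pascal rules, the combination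
`(1 - q^{d+k+1}) Σ(j+1, k+1) - q (1 - q^{j+1}) Σ(j, k)` telescopes to a boundary term with an
explicit limit, and `S` satisfies the resulting recursion in `(j, k)`.
-/

noncomputable section

/-! ### `q`-factorials and `q`-binomial coefficients -/

section QBinomial

variable {q : ℝ}

theorem qPoch_zero (q : ℝ) : qPoch q 0 = 1 := by simp [qPoch]

theorem qPoch_succ (q : ℝ) (n : ℕ) : qPoch q (n + 1) = qPoch q n * (1 - q ^ (n + 1)) := by
  rw [qPoch, Finset.prod_Icc_succ_top (by omega), ← qPoch]

theorem one_sub_pow_ne_zero (hq : |q| ≠ 1) (n : ℕ) : 1 - q ^ (n + 1) ≠ 0 := by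
  intro h
  have habs : |q| ^ (n + 1) = 1 := by rw [← abs_pow, ← sub_eq_zero.1 h, abs_one]
  exact hq ((pow_eq_one_iff_of_nonneg (abs_nonneg q) n.succ_ne_zero).1 habs)

theorem qPoch_ne_zero (hq : |q| ≠ 1) (n : ℕ) : qPoch q n ≠ 0 := by
  induction n with
  | zero => simp [qPoch_zero]
  | succ n ih => rw [qPoch_succ]; exact mul_ne_zero ih (one_sub_pow_ne_zero hq n)

theorem qBinom_of_lt {n m : ℕ} (h : n < m) : qBinom q n m = 0 := if_neg h.not_ge

theorem qBinom_add (hq : |q| ≠ 1) (n m : ℕ) :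
    qBinom q (n + m) m = qPoch q (n + m) / (qPoch q m * qPoch q n) := by
  have h1 : 1 - q ≠ 0 := by simpa using one_sub_pow_ne_zero hq 0
  have hn := qPoch_ne_zero hq n
  have hm := qPoch_ne_zero hq m
  rw [qBinom, if_pos (by omega), Nat.add_sub_cancel]
  simp only [qGamma]
  rw [pow_add]
  field_simp

theorem qBinom_zero_right (hq : |q| ≠ 1) (n : ℕ) : qBinom q n 0 = 1 := by
  simpa [qPoch_zero, qPoch_ne_zero hq n] using qBinom_add hq n 0

theorem qBinom_self (hq : |q| ≠ 1) (n : ℕ) : qBinom q n n = 1 := by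
  simpa [qPoch_zero, qPoch_ne_zero hq n] using qBinom_add hq 0 n

theorem qBinom_symm_add (hq : |q| ≠ 1) (n m : ℕ) :
    qBinom q (n + m) n = qBinom q (n + m) m := by
  rw [qBinom_add hq n m, add_comm n m, qBinom_add hq m n, mul_comm]

theorem qBinom_succ_succ_mul (hq : |q| ≠ 1) (n k : ℕ) :
    qBinom q (n + 1) (k + 1) * (1 - q ^ (k + 1)) = (1 - q ^ (n + 1)) * qBinom q n k := by
  rcases lt_or_ge n k with h | h
  · simp [qBinom_of_lt h, qBinom_of_lt (Nat.succ_lt_succ h)]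
  · obtain ⟨m, rfl⟩ := Nat.exists_eq_add_of_le' h
    have hk := qPoch_ne_zero hq k
    have hm := qPoch_ne_zero hq m
    have hk' := one_sub_pow_ne_zero hq k
    rw [add_assoc, qBinom_add hq, qBinom_add hq, ← add_assoc, qPoch_succ, qPoch_succ]
    field_simp

theorem qBinom_succ_mul_sub (hq : |q| ≠ 1) (n k : ℕ) :
    qBinom q (n + 1) k * (q ^ k - q ^ (n + 1)) = q ^ k * (1 - q ^ (n + 1)) * qBinom q n k := by
  rcases lt_or_ge n k with h | h
  · rcases Nat.lt_or_eq_of_le h with h' | rfl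
    · simp [qBinom_of_lt h, qBinom_of_lt h']
    · simp [qBinom_of_lt h]
  · obtain ⟨m, rfl⟩ := Nat.exists_eq_add_of_le' h
    have hk := qPoch_ne_zero hq k
    have hm := qPoch_ne_zero hq m
    have hm' := one_sub_pow_ne_zero hq m
    rw [add_right_comm, qBinom_add hq, qBinom_add hq, add_right_comm, qPoch_succ, qPoch_succ]
    field_simp
    ring

theorem qBinom_succ_succ (hq : |q| ≠ 1) (n m : ℕ) :
    qBinom q (n + 1) (m + 1) = q ^ (m + 1) * qBinom q n (m + 1) + qBinom q n m := by
  rcases lt_trichotomy n m with h | rfl | h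
  · simp [qBinom_of_lt h, qBinom_of_lt (Nat.succ_lt_succ h), qBinom_of_lt (h.trans m.lt_succ_self)]
  · simp [qBinom_self hq, qBinom_of_lt n.lt_succ_self]
  · obtain ⟨s, rfl⟩ := Nat.exists_eq_add_of_lt h
    have hs := qPoch_ne_zero hq s
    have hm := qPoch_ne_zero hq m
    have hs' := one_sub_pow_ne_zero hq s
    have hm' := one_sub_pow_ne_zero hq m
    rw [show m + s + 1 = s + (m + 1) by ring, qBinom_add hq s (m + 1),
      show s + (m + 1) = s + 1 + m by ring, qBinom_add hq (s + 1) m, add_assoc (s + 1) m 1,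
      qBinom_add hq (s + 1) (m + 1), show s + 1 + (m + 1) = s + 1 + m + 1 by ring,
      qPoch_succ q (s + 1 + m), qPoch_succ q m, qPoch_succ q s]
    field_simp
    ring

theorem choose_two_succ (n : ℕ) : (n + 1).choose 2 = n.choose 2 + n := by
  rw [Nat.choose_succ_succ' n 1, Nat.choose_one_right, add_comm]

theorem choose_two_add (m n : ℕ) : (m + n).choose 2 = m.choose 2 + n.choose 2 + m * n := by
  induction n with
  | zero => simp
  | succ n ih => rw [← add_assoc, choose_two_succ, choose_two_succ, ih]; ring

end QBinomial

/-! ### The `q`-binomial theorem -/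

section QBinomialTheorem

open Polynomial

variable {q : ℝ}

/-- The shifted power `(X + y)(X + qy)⋯(X + q^(n-1) y)` expanded by the `q`-binomial theorem. -/
def qShiftedPow (q y : ℝ) (n : ℕ) : ℝ[X] := ∏ i ∈ Finset.range n, (X + C (y * q ^ i))

theorem qShiftedPow_succ (q y : ℝ) (n : ℕ) :
    qShiftedPow q y (n + 1) = qShiftedPow q y n * (X + C (y * q ^ n)) :=
  Finset.prod_range_succ _ n

theorem qShiftedPow_add (q y : ℝ) (m n : ℕ) :
    qShiftedPow q y (m + n) = qShiftedPow q y m * qShiftedPow q (y * q ^ m) n := by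
  simp only [qShiftedPow, Finset.prod_range_add, mul_assoc, pow_add]

theorem coeff_qShiftedPow (hq : |q| ≠ 1) (y : ℝ) (n a : ℕ) :
    (qShiftedPow q y n).coeff a = y ^ (n - a) * q ^ (n - a).choose 2 * qBinom q n a := by
  induction n generalizing a with
  | zero =>
    cases a with
    | zero => simp [qShiftedPow, qBinom_self hq]
    | succ a => simp [qShiftedPow, qBinom_of_lt, coeff_one]
  | succ n ih =>
    cases a with
    | zero =>
      rw [qShiftedPow_succ, mul_add, coeff_add, coeff_mul_X_zero, coeff_mul_C, ih,
        qBinom_zero_right hq, qBinom_zero_right hq, Nat.sub_zero, Nat.sub_zero, choose_two_succ]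
      ring
    | succ a =>
      rw [qShiftedPow_succ, mul_add, coeff_add, coeff_mul_X, coeff_mul_C, ih, ih,
        Nat.add_sub_add_right, qBinom_succ_succ hq]
      rcases lt_or_ge a n with h | h
      · obtain ⟨m, rfl⟩ := Nat.exists_eq_add_of_lt h
        rw [show a + m + 1 - a = m + 1 by omega, show a + m + 1 - (a + 1) = m by omega,
          choose_two_succ]
        ring
      · simp [qBinom_of_lt (Nat.lt_succ_of_le h)]

theorem natDegree_qShiftedPow_lt (q y : ℝ) (n : ℕ) : (qShiftedPow q y n).natDegree < n + 1 := by
  rw [qShiftedPow, natDegree_prod_of_monic _ _ fun i _ => monic_X_add_C _]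
  simp only [natDegree_X_add_C, Finset.sum_const, Finset.card_range, smul_eq_mul, mul_one,
    Nat.lt_succ_self]

theorem sum_neg_one_pow_mul_qBinom (hq : |q| ≠ 1) (n : ℕ) :
    ∑ a ∈ Finset.range (n + 1), (-1) ^ a * (q ^ (n - a).choose 2 * qBinom q n a) =
      if n = 0 then 1 else 0 := by
  have heval := eval_eq_sum_range' (natDegree_qShiftedPow_lt q 1 n) (-1)
  simp only [coeff_qShiftedPow hq, one_pow, one_mul] at heval
  rw [Finset.sum_congr rfl fun a _ => mul_comm _ _, ← heval]
  cases n with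
  | zero => simp [qShiftedPow]
  | succ n => simp [qShiftedPow, eval_prod, Finset.prod_range_succ']

theorem qBinom_mul_qBinom (hq : |q| ≠ 1) (r m n : ℕ) :
    qBinom q (r + (m + n)) (r + m) * qBinom q (r + m) r =
      qBinom q (r + (m + n)) r * qBinom q (m + n) m := by
  have hr := qPoch_ne_zero hq r
  have hm := qPoch_ne_zero hq m
  have hn := qPoch_ne_zero hq n
  have hrm := qPoch_ne_zero hq (r + m)
  have hmn := qPoch_ne_zero hq (m + n)
  rw [qBinom_symm_add hq r (m + n), qBinom_symm_add hq r m, qBinom_symm_add hq m n,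
    ← add_assoc, qBinom_symm_add hq (r + m) n, qBinom_add hq (r + m) n, qBinom_add hq r m,
    qBinom_add hq m n, add_assoc, qBinom_add hq r (m + n)]
  field_simp

theorem sum_qBinom_mul_neg_one_pow_mul_qBinom (hq : |q| ≠ 1) (r : ℕ) {s n : ℕ} (hs : s < n) :
    ∑ b ∈ Finset.range n,
        (-1) ^ (b + r) * qBinom q b r * (q ^ (s - b).choose 2 * qBinom q s b) =
      if r = s then 1 else 0 := by
  have hsupport : ∀ b, s < b ∨ b < r → (-1) ^ (b + r) * qBinom q b r *
      (q ^ (s - b).choose 2 * qBinom q s b) = 0 := by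
    rintro b (h | h) <;> simp [qBinom_of_lt h]
  rcases lt_or_ge s r with h | h
  · rw [if_neg h.ne', Finset.sum_eq_zero fun b _ => hsupport b (by omega)]
  obtain ⟨p, rfl⟩ := Nat.exists_eq_add_of_le h
  obtain ⟨t, rfl⟩ := Nat.exists_eq_add_of_le hs
  have hterm : ∀ i ∈ Finset.range (p + 1),
      (-1) ^ (r + i + r) * qBinom q (r + i) r *
          (q ^ (r + p - (r + i)).choose 2 * qBinom q (r + p) (r + i)) =
        qBinom q (r + p) r * ((-1) ^ i * (q ^ (p - i).choose 2 * qBinom q p i)) := by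
    intro i hi
    obtain ⟨m, rfl⟩ := Nat.exists_eq_add_of_le (Finset.mem_range_succ_iff.1 hi)
    have hrevision := qBinom_mul_qBinom hq r i m
    have hsign : (-1 : ℝ) ^ (r + i + r) = (-1) ^ i := by
      rw [add_right_comm, pow_add, Even.neg_one_pow ⟨r, rfl⟩, one_mul]
    rw [hsign, Nat.add_sub_add_left]
    linear_combination (-1) ^ i * q ^ (i + m - i).choose 2 * hrevision
  rw [show (r + p).succ + t = r + (p + 1) + t by omega, Finset.sum_range_add,
    Finset.sum_range_add,
    Finset.sum_eq_zero fun b hb => hsupport b (.inr (Finset.mem_range.1 hb)),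
    Finset.sum_eq_zero (s := Finset.range t) fun b _ => hsupport _ (.inl (by omega)),
    Finset.sum_congr rfl hterm, ← Finset.mul_sum, sum_neg_one_pow_mul_qBinom hq]
  rcases Nat.eq_zero_or_pos p with rfl | hp
  · simp [qBinom_self hq]
  · simp [hp.ne']

/-- The complete homogeneous symmetric polynomial `h_m(1, q, …, q^(d-1))`; the truncated
subtraction gives the correct values `1, 0, 0, …` for `d = 0`. -/
def qHomog (q : ℝ) (d m : ℕ) : ℝ := qBinom q (d + m - 1) m

theorem qHomog_zero_right (hq : |q| ≠ 1) (d : ℕ) : qHomog q d 0 = 1 := qBinom_zero_right hq _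

theorem qHomog_zero_succ (m : ℕ) : qHomog q 0 (m + 1) = 0 := qBinom_of_lt (by omega)

theorem qHomog_succ_left (d m : ℕ) : qHomog q (d + 1) m = qBinom q (d + m) m := by
  rw [qHomog, add_right_comm, Nat.add_sub_cancel]

theorem qHomog_succ_succ (hq : |q| ≠ 1) (d m : ℕ) :
    qHomog q (d + 1) (m + 1) = q ^ (m + 1) * qHomog q d (m + 1) + qHomog q (d + 1) m := by
  rw [qHomog_succ_left, qHomog_succ_left, ← add_assoc, qBinom_succ_succ hq]
  rfl

/-- The power series inverse to `qShiftedPow q 1 d`: up to the rescaling that makes its constant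
term invertible, the generating function of the complete homogeneous symmetric polynomials. -/
def qHomogSeries (q : ℝ) (d : ℕ) : PowerSeries ℝ :=
  PowerSeries.mk fun m => (-1) ^ m * (q / q ^ d) ^ m / q ^ d.choose 2 * qHomog q d m

theorem X_add_C_mul_qHomogSeries_succ (hq0 : q ≠ 0) (hq : |q| ≠ 1) (d : ℕ) :
    (PowerSeries.X + PowerSeries.C (q ^ d)) * qHomogSeries q (d + 1) = qHomogSeries q d := by
  ext m
  rw [add_mul, map_add, PowerSeries.coeff_C_mul]
  cases m with
  | zero =>
    simp only [PowerSeries.coeff_zero_X_mul, qHomogSeries, PowerSeries.coeff_mk, pow_zero,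
      qHomog_zero_right hq, choose_two_succ, pow_add]
    field_simp
    ring
  | succ m =>
    simp only [PowerSeries.coeff_succ_X_mul, qHomogSeries, PowerSeries.coeff_mk,
      qHomog_succ_succ hq d m, choose_two_succ, pow_add, pow_one, div_pow, mul_pow]
    field_simp
    ring

theorem qShiftedPow_mul_qHomogSeries (hq0 : q ≠ 0) (hq : |q| ≠ 1) (d : ℕ) :
    (qShiftedPow q 1 d : PowerSeries ℝ) * qHomogSeries q d = 1 := by
  induction d with
  | zero =>
    ext m
    cases m with
    | zero => simp [qShiftedPow, qHomogSeries, qHomog_zero_right hq]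
    | succ m => simp [qShiftedPow, qHomogSeries, qHomog_zero_succ, PowerSeries.coeff_one]
  | succ d ih =>
    rw [qShiftedPow_succ, Polynomial.coe_mul, Polynomial.coe_add, Polynomial.coe_X,
      Polynomial.coe_C, one_mul, mul_assoc, X_add_C_mul_qHomogSeries_succ hq0 hq, ih]

end QBinomialTheorem

/-! ### Toeplitz matrices -/

section LowerToeplitz

variable {R : Type*} [CommSemiring R]

/-- The lower triangular `n × n` Toeplitz matrix of a formal power series `f`: multiplication by
`f` modulo `X ^ n`, in the basis of monomials. -/
def lowerToeplitz (f : PowerSeries R) (n : ℕ) : Matrix (Fin n) (Fin n) R :=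
  Matrix.of fun i j => (PowerSeries.X ^ (j : ℕ) * f).coeff i

theorem lowerToeplitz_apply (f : PowerSeries R) (n : ℕ) (i j : Fin n) :
    lowerToeplitz f n i j = if (j : ℕ) ≤ i then f.coeff (i - j : ℕ) else 0 :=
  PowerSeries.coeff_X_pow_mul' f j i

theorem lowerToeplitz_isLowerTriangular (f : PowerSeries R) (n : ℕ) :
    (lowerToeplitz f n).IsLowerTriangular := by
  intro i j hij
  rw [lowerToeplitz_apply]
  exact if_neg (not_le.2 hij)

theorem lowerToeplitz_one (n : ℕ) : lowerToeplitz (1 : PowerSeries R) n = 1 := by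
  ext i j
  simp only [lowerToeplitz, Matrix.of_apply, mul_one, PowerSeries.coeff_X_pow, Matrix.one_apply,
    Fin.ext_iff]

theorem lowerToeplitz_mulVec_coeff (f g : PowerSeries R) (n : ℕ) (i : Fin n) :
    (lowerToeplitz f n).mulVec (fun r => g.coeff r) i = (f * g).coeff i := by
  obtain ⟨t, ht⟩ := Nat.exists_eq_add_of_le i.2
  simp only [Matrix.mulVec, dotProduct, lowerToeplitz_apply]
  rw [Fin.sum_univ_eq_sum_range
      (fun r => (if r ≤ i then f.coeff (i - r : ℕ) else 0) * g.coeff r) n,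
    Finset.sum_congr (congrArg Finset.range ht) fun _ _ => rfl, Finset.sum_range_add,
    Finset.sum_eq_zero (s := Finset.range t) fun r _ => by rw [if_neg (by omega), zero_mul],
    add_zero, mul_comm f, PowerSeries.coeff_mul, Finset.Nat.sum_antidiagonal_eq_sum_range_succ_mk]
  refine Finset.sum_congr rfl fun r hr => ?_
  rw [if_pos (Finset.mem_range_succ_iff.1 hr), mul_comm]

theorem lowerToeplitz_mul (f g : PowerSeries R) (n : ℕ) :
    lowerToeplitz (f * g) n = lowerToeplitz f n * lowerToeplitz g n := by
  ext i j
  calc lowerToeplitz (f * g) n i j = (f * (PowerSeries.X ^ (j : ℕ) * g)).coeff i :=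
        congrArg (PowerSeries.coeff (i : ℕ)) (mul_left_comm _ _ _)
    _ = _ := (lowerToeplitz_mulVec_coeff f _ n i).symm

end LowerToeplitz

section ElemToeplitz

open Matrix

variable {q : ℝ}

/-- The elementary symmetric function `e_z(1, q, q², …)`, extended by zero to negative `z`. -/
def qElem (q : ℝ) : ℤ → ℝ :=
  Function.extend (↑) (fun n : ℕ => q ^ n.choose 2 / qPoch q n) 0

theorem qElem_natCast (q : ℝ) (n : ℕ) : qElem q n = q ^ n.choose 2 / qPoch q n :=
  Nat.cast_injective.extend_apply _ _ n

theorem qElem_of_neg (q : ℝ) {z : ℤ} (hz : z < 0) : qElem q z = 0 :=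
  Function.extend_apply' _ _ _ (by rintro ⟨n, rfl⟩; omega)

theorem qElem_sub (hq : |q| ≠ 1) (m a : ℕ) :
    qElem q (m - a) = qPoch q a * (qShiftedPow q 1 m).coeff a / qPoch q m := by
  rw [coeff_qShiftedPow hq]
  rcases lt_or_ge m a with h | h
  · rw [qElem_of_neg q (by omega), qBinom_of_lt h]
    simp
  · obtain ⟨n, rfl⟩ := Nat.exists_eq_add_of_le' h
    have ha := qPoch_ne_zero hq a
    have hna := qPoch_ne_zero hq (n + a)
    rw [qBinom_add hq, Nat.add_sub_cancel, Nat.cast_add, add_sub_cancel_right, qElem_natCast]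
    field_simp
    ring

/-- The change of basis from the shifted powers `qShiftedPow q y b` to the monomials. -/
def qShiftMatrix (q y : ℝ) (n : ℕ) : Matrix (Fin n) (Fin n) ℝ :=
  Matrix.of fun r b => (qShiftedPow q y b).coeff r

/-- The inverse of `qShiftMatrix q y n`, see `qShiftMatrixInv_mul`. -/
def qShiftMatrixInv (q y : ℝ) (n : ℕ) : Matrix (Fin n) (Fin n) ℝ :=
  Matrix.of fun r b => (-1) ^ (b + r : ℕ) * y ^ (b - r : ℕ) * qBinom q b r

theorem qShiftMatrixInv_mul (hq : |q| ≠ 1) (y : ℝ) (n : ℕ) :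
    qShiftMatrixInv q y n * qShiftMatrix q y n = 1 := by
  ext r s
  have hterm : ∀ b : ℕ, (-1) ^ (b + r : ℕ) * y ^ (b - r : ℕ) * qBinom q b r *
      (y ^ (s - b) * q ^ (s - b).choose 2 * qBinom q s b) =
      y ^ (s - r : ℕ) *
        ((-1) ^ (b + r : ℕ) * qBinom q b r * (q ^ (s - b).choose 2 * qBinom q s b)) := by
    intro b
    rcases lt_or_ge b r with h | hrb
    · simp [qBinom_of_lt h]
    rcases lt_or_ge (s : ℕ) b with h | hbs
    · simp [qBinom_of_lt h]
    rw [show (s - r : ℕ) = (b - r) + (s - b) by omega, pow_add]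
    ring
  simp only [Matrix.mul_apply, qShiftMatrixInv, qShiftMatrix, Matrix.of_apply,
    coeff_qShiftedPow hq, hterm]
  rw [Fin.sum_univ_eq_sum_range (fun b => y ^ (s - r : ℕ) * ((-1) ^ (b + r : ℕ) * qBinom q b r *
      (q ^ (s - b).choose 2 * qBinom q s b))) n, ← Finset.mul_sum,
    sum_qBinom_mul_neg_one_pow_mul_qBinom hq _ s.2]
  rcases eq_or_ne r s with rfl | h
  · simp
  · rw [if_neg (Fin.val_ne_of_ne h), Matrix.one_apply_ne h, mul_zero]

/-- The Toeplitz matrix of the elementary symmetric functions of `1, q, q², …`. -/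
def elemToeplitz (q : ℝ) (d n : ℕ) : Matrix (Fin n) (Fin n) ℝ :=
  Matrix.of fun a b => qElem q ((d + b : ℕ) - (a : ℕ))

/-- The inverse of `elemToeplitz q d n`, see `elemToeplitzInv_mul`. -/
def elemToeplitzInv (q : ℝ) (d n : ℕ) : Matrix (Fin n) (Fin n) ℝ :=
  diagonal (fun b : Fin n => qPoch q (d + b)) *
    (qShiftMatrixInv q (q ^ d) n * lowerToeplitz (qHomogSeries q d) n) *
    diagonal (fun a : Fin n => (qPoch q a)⁻¹)

-- The `q`-Vandermonde convolution is the factorization of the shifted power of order `d + b`.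
theorem elemToeplitz_eq_mul (hq : |q| ≠ 1) (d n : ℕ) :
    elemToeplitz q d n = diagonal (fun a : Fin n => qPoch q a) *
      (lowerToeplitz (qShiftedPow q 1 d : PowerSeries ℝ) n * qShiftMatrix q (q ^ d) n) *
      diagonal (fun b : Fin n => (qPoch q (d + b))⁻¹) := by
  ext a b
  have hconvolution : (lowerToeplitz (qShiftedPow q 1 d : PowerSeries ℝ) n *
      qShiftMatrix q (q ^ d) n) a b = (qShiftedPow q 1 (d + b)).coeff a := by
    rw [qShiftedPow_add, one_mul, ← Polynomial.coeff_coe, Polynomial.coe_mul,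
      ← lowerToeplitz_mulVec_coeff]
    simp only [Polynomial.coeff_coe]
    rfl
  rw [mul_diagonal, diagonal_mul, hconvolution, elemToeplitz, Matrix.of_apply, qElem_sub hq,
    div_eq_mul_inv]

theorem elemToeplitzInv_mul (hq0 : q ≠ 0) (hq : |q| ≠ 1) (d n : ℕ) :
    elemToeplitzInv q d n * elemToeplitz q d n = 1 := by
  have hinv : lowerToeplitz (qHomogSeries q d) n *
      lowerToeplitz (qShiftedPow q 1 d : PowerSeries ℝ) n = 1 := by
    rw [← lowerToeplitz_mul, mul_comm, qShiftedPow_mul_qHomogSeries hq0 hq, lowerToeplitz_one]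
  have hleft : diagonal (fun a : Fin n => (qPoch q a)⁻¹) *
      diagonal (fun a : Fin n => qPoch q a) = 1 := by
    simp [diagonal_mul_diagonal, qPoch_ne_zero hq]
  have hright : diagonal (fun b : Fin n => qPoch q (d + b)) *
      diagonal (fun b : Fin n => (qPoch q (d + b))⁻¹) = 1 := by
    simp [diagonal_mul_diagonal, qPoch_ne_zero hq]
  rw [elemToeplitzInv, elemToeplitz_eq_mul hq]
  simp only [Matrix.mul_assoc]
  rw [← Matrix.mul_assoc (diagonal fun a : Fin n => (qPoch q a)⁻¹), hleft, Matrix.one_mul,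
    ← Matrix.mul_assoc (lowerToeplitz (qHomogSeries q d) n), hinv, Matrix.one_mul,
    ← Matrix.mul_assoc (qShiftMatrixInv q (q ^ d) n), qShiftMatrixInv_mul hq, Matrix.one_mul,
    hright]

/-- The sum over `r` in the closed form of the skew Schur function, with `r = j + m`. -/
def hookSum (q : ℝ) (d j k n : ℕ) : ℝ :=
  ∑ m ∈ Finset.range n, q ^ (j + m) * qBinom q (j + m) k * qHomog q d m

theorem qShiftMatrixInv_mul_lowerToeplitz_apply (hq0 : q ≠ 0) (d n : ℕ) (k j : Fin n) :
    (qShiftMatrixInv q (q ^ d) n * lowerToeplitz (qHomogSeries q d) n) k j =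
      (-1) ^ (j + k : ℕ) *
        ((q ^ d) ^ (j : ℕ) / (q ^ (j : ℕ) * (q ^ d) ^ (k : ℕ) * q ^ d.choose 2)) *
        hookSum q d j k (n - j) := by
  obtain ⟨k, hk⟩ := k
  obtain ⟨j, hj⟩ := j
  obtain ⟨t, rfl⟩ := Nat.exists_eq_add_of_le hj.le
  have hterm : ∀ m : ℕ, (-1) ^ (j + m + k) * (q ^ d) ^ (j + m - k) * qBinom q (j + m) k *
      ((-1) ^ m * (q / q ^ d) ^ m / q ^ d.choose 2 * qHomog q d m) =
      (-1) ^ (j + k) * ((q ^ d) ^ j / (q ^ j * (q ^ d) ^ k * q ^ d.choose 2)) *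
        (q ^ (j + m) * qBinom q (j + m) k * qHomog q d m) := by
    intro m
    rcases lt_or_ge (j + m) k with h | h
    · simp [qBinom_of_lt h]
    have hsign : (-1 : ℝ) ^ m * (-1) ^ m = 1 := by rw [← mul_pow, neg_one_mul, neg_neg, one_pow]
    rw [pow_sub₀ _ (pow_ne_zero d hq0) h, pow_add (-1 : ℝ), pow_add (-1 : ℝ) j m,
      pow_add (-1 : ℝ) j k, div_pow, pow_add, pow_add]
    field_simp
    linear_combination qBinom q (j + m) k * qHomog q d m * hsign
  simp only [Matrix.mul_apply, qShiftMatrixInv, Matrix.of_apply, lowerToeplitz_apply,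
    qHomogSeries, PowerSeries.coeff_mk]
  rw [Fin.sum_univ_eq_sum_range (fun r => (-1) ^ (r + k) * (q ^ d) ^ (r - k) * qBinom q r k *
      (if j ≤ r then (-1) ^ (r - j) * (q / q ^ d) ^ (r - j) / q ^ d.choose 2 *
        qHomog q d (r - j) else 0)) (j + t), Finset.sum_range_add,
    Finset.sum_eq_zero fun r hr => by rw [if_neg (by simpa using hr), mul_zero],
    zero_add, hookSum, Nat.add_sub_cancel_left, Finset.mul_sum]
  refine Finset.sum_congr rfl fun m _ => ?_
  rw [if_pos (Nat.le_add_right j m), Nat.add_sub_cancel_left, hterm]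

theorem det_elemToeplitz (hq : |q| ≠ 1) (d n : ℕ) :
    (elemToeplitz q d n).det =
      ∏ b ∈ Finset.range n, q ^ d.choose 2 * (qPoch q b / qPoch q (d + b)) := by
  have hlower : (lowerToeplitz (qShiftedPow q 1 d : PowerSeries ℝ) n).det =
      ∏ _b : Fin n, q ^ d.choose 2 := by
    rw [det_of_isLowerTriangular _ (lowerToeplitz_isLowerTriangular _ n)]
    simp only [lowerToeplitz_apply, le_refl, if_true, Nat.sub_self, Polynomial.coeff_coe,
      coeff_qShiftedPow hq, one_pow, one_mul, Nat.sub_zero, qBinom_zero_right hq, mul_one]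
  have hupper : (qShiftMatrix q (q ^ d) n).det = 1 := by
    rw [det_of_isUpperTriangular]
    · simp [qShiftMatrix, coeff_qShiftedPow hq, qBinom_self hq]
    · intro r b hrb
      simp [qShiftMatrix, coeff_qShiftedPow hq, qBinom_of_lt (show (b : ℕ) < r from hrb)]
  rw [elemToeplitz_eq_mul hq, det_mul, det_mul, det_mul, det_diagonal, det_diagonal, hlower,
    hupper, mul_one, ← Finset.prod_mul_distrib, ← Finset.prod_mul_distrib,
    ← Fin.prod_univ_eq_prod_range (fun b => q ^ d.choose 2 * (qPoch q b / qPoch q (d + b)))]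
  refine Finset.prod_congr rfl fun b _ => ?_
  rw [div_eq_mul_inv]
  ring

theorem det_elemToeplitz_submatrix (hq0 : q ≠ 0) (hq : |q| ≠ 1) (d N : ℕ) (j k : Fin (N + 1)) :
    ((elemToeplitz q d (N + 1)).submatrix j.succAbove k.succAbove).det =
      (q ^ d.choose 2) ^ N * (∏ b ∈ Finset.range (N + 1), qPoch q b / qPoch q (d + b)) *
        ((q ^ d) ^ (j : ℕ) / (q ^ (j : ℕ) * (q ^ d) ^ (k : ℕ))) *
        (qPoch q (d + k) / qPoch q j) * hookSum q d j k (N + 1 - j) := by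
  set T := elemToeplitz q d (N + 1)
  have hadjugate : T.adjugate = T.det • elemToeplitzInv q d (N + 1) := by
    rw [← Matrix.one_mul T.adjugate, ← elemToeplitzInv_mul hq0 hq, Matrix.mul_assoc,
      Matrix.mul_adjugate, Matrix.mul_smul, Matrix.mul_one]
  have hsign : (-1 : ℝ) ^ (j + k : ℕ) * (-1) ^ (j + k : ℕ) = 1 := by
    rw [← mul_pow, neg_one_mul, neg_neg, one_pow]
  have hminor : (T.submatrix j.succAbove k.succAbove).det =
      (-1) ^ (j + k : ℕ) * T.adjugate k j := by
    rw [adjugate_fin_succ_eq_det_submatrix, ← mul_assoc, hsign, one_mul]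
  rw [hminor, hadjugate, Matrix.smul_apply, smul_eq_mul, elemToeplitzInv, mul_diagonal,
    diagonal_mul, qShiftMatrixInv_mul_lowerToeplitz_apply hq0,
    det_elemToeplitz hq, Finset.prod_mul_distrib, Finset.prod_const, Finset.card_range,
    pow_succ]
  have hj := qPoch_ne_zero hq j
  field_simp
  linear_combination (∏ b ∈ Finset.range (N + 1), qPoch q b / qPoch q (d + b)) *
    qPoch q (d + k) * hookSum q d j k (N + 1 - j) * hsign

end ElemToeplitz

/-! ### The dual Jacobi–Trudi determinant -/

section DualJacobiTrudi

variable {R : Type*} [CommRing R] {n : ℕ}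

/-- The elementary symmetric function `e_z` of a multiset, extended by zero to negative `z`. -/
def elemSymm (s : Multiset R) : ℤ → R := Function.extend (↑) s.esymm 0

theorem elemSymm_natCast (s : Multiset R) (n : ℕ) : elemSymm s n = s.esymm n :=
  Nat.cast_injective.extend_apply _ _ n

theorem elemSymm_of_neg (s : Multiset R) {z : ℤ} (hz : z < 0) : elemSymm s z = 0 :=
  Function.extend_apply' _ _ _ (by rintro ⟨n, rfl⟩; omega)

theorem elemSymm_zero_left (z : ℤ) : elemSymm (0 : Multiset R) z = if z = 0 then 1 else 0 := by
  rcases lt_or_ge z 0 with hz | hz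
  · rw [elemSymm_of_neg _ hz, if_neg hz.ne]
  · obtain ⟨n, rfl⟩ := Int.eq_ofNat_of_zero_le hz
    rw [elemSymm_natCast]
    cases n <;> simp [Multiset.esymm, Multiset.powersetCard_zero_right, Nat.cast_add_one_ne_zero]

theorem elemSymm_cons (a : R) (s : Multiset R) (z : ℤ) :
    elemSymm (a ::ₘ s) z = elemSymm s z + a * elemSymm s (z - 1) := by
  rcases lt_or_ge z 0 with hz | hz
  · simp [elemSymm_of_neg _ hz, elemSymm_of_neg s (show z - 1 < 0 by omega)]
  · obtain ⟨n, rfl⟩ := Int.eq_ofNat_of_zero_le hz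
    cases n with
    | zero =>
      rw [elemSymm_of_neg s (z := _ - 1) (by simp), elemSymm_natCast, elemSymm_natCast]
      simp [Multiset.esymm]
    | succ n =>
      rw [Nat.cast_succ, add_sub_cancel_right, ← Nat.cast_succ]
      simp only [elemSymm_natCast, Multiset.esymm, Multiset.powersetCard_cons, Multiset.map_add,
        Multiset.map_map, Function.comp_apply, Multiset.prod_cons, Multiset.sum_add,
        Multiset.sum_map_mul_left]

/-- The dual Jacobi–Trudi determinant of the elementary symmetric functions of `s`, for the skew
shape with column lengths `l` and `m`. -/
def dualJacobiTrudi (s : Multiset R) (l m : Fin n → ℕ) : R :=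
  (Matrix.of fun c i : Fin n => elemSymm s ((l i : ℤ) - i - m c + c)).det

/-- The column lengths after one cell has been added to each of the columns in `S`. -/
def addCells (m : Fin n → ℕ) (S : Finset (Fin n)) (c : Fin n) : ℕ :=
  m c + if c ∈ S then 1 else 0

theorem dualJacobiTrudi_cons (a : R) (s : Multiset R) (l m : Fin n → ℕ) :
    dualJacobiTrudi (a ::ₘ s) l m =
      ∑ S : Finset (Fin n), a ^ S.card * dualJacobiTrudi s l (addCells m S) := by
  let shifted : Fin n → Fin n → R := fun c i =>
    a * elemSymm s ((l i : ℤ) - i - m c + c - 1)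
  let unshifted : Fin n → Fin n → R := fun c i => elemSymm s ((l i : ℤ) - i - m c + c)
  have hsplit : dualJacobiTrudi (a ::ₘ s) l m =
      Matrix.detRowAlternating (shifted + unshifted) := by
    refine congrArg Matrix.det (Matrix.ext fun c i => ?_)
    simp only [Matrix.of_apply, elemSymm_cons, Pi.add_apply, shifted, unshifted]
    rw [add_comm]
  have hmultilinear :
      Matrix.detRowAlternating (shifted + unshifted) =
        ∑ S : Finset (Fin n), Matrix.detRowAlternating (S.piecewise shifted unshifted) :=
    Matrix.detRowAlternating.map_add_univ shifted unshifted
  rw [hsplit, hmultilinear]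
  refine Finset.sum_congr rfl fun S _ => ?_
  have hscale := Matrix.det_mul_column (fun c : Fin n => if c ∈ S then a else 1)
    (Matrix.of fun c i : Fin n => elemSymm s ((l i : ℤ) - i - addCells m S c + c))
  rw [Finset.prod_ite_mem, Finset.univ_inter, Finset.prod_const] at hscale
  rw [dualJacobiTrudi, ← hscale]
  refine congrArg Matrix.det (Matrix.ext fun c i => ?_)
  by_cases hc : c ∈ S
  · simp only [Finset.piecewise_eq_of_mem _ _ _ hc, Matrix.of_apply, if_pos hc, addCells, shifted]
    rw [Nat.cast_add, Nat.cast_one, ← sub_sub (_ - _), ← sub_add_eq_add_sub]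
  · simp only [Finset.piecewise_eq_of_notMem _ _ _ hc, Matrix.of_apply, if_neg hc, addCells,
      one_mul, add_zero, unshifted]

-- If adding the cells breaks the shape, two consecutive rows of the determinant agree.
theorem dualJacobiTrudi_addCells_eq_zero (s : Multiset R) (l : Fin n → ℕ) {m : Fin n → ℕ}
    (hm : Antitone m) {S : Finset (Fin n)} (hS : ¬ Antitone (addCells m S)) :
    dualJacobiTrudi s l (addCells m S) = 0 := by
  rcases n with _ | n
  · exact absurd (fun a => a.elim0) hS
  rw [Fin.antitone_iff_succ_le] at hS
  push Not at hS
  obtain ⟨c, hc⟩ := hS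
  have hle : m c.succ ≤ m c.castSucc := hm Fin.castSucc_lt_succ.le
  have hstep : addCells m S c.succ = addCells m S c.castSucc + 1 := by
    unfold addCells at hc ⊢
    split_ifs at hc ⊢ <;> omega
  refine Matrix.det_zero_of_row_eq (i := c.castSucc) (j := c.succ)
    Fin.castSucc_lt_succ.ne (funext fun i => ?_)
  simp only [Matrix.of_apply]
  congr 1
  rw [hstep, Fin.val_succ, Fin.val_castSucc]
  push_cast
  ring

theorem strictMono_val_sub {m : Fin n → ℕ} (hm : Antitone m) :
    StrictMono fun c : Fin n => (c : ℤ) - m c := by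
  intro a b hab
  have := hm hab.le
  have : (a : ℕ) < b := hab
  dsimp only
  omega

theorem dualJacobiTrudi_zero {l m : Fin n → ℕ} (hl : Antitone l) (hm : Antitone m) :
    dualJacobiTrudi (0 : Multiset R) l m = if l = m then 1 else 0 := by
  have hentry : ∀ c i : Fin n, (l i : ℤ) - i - m c + c = 0 ↔ (i : ℤ) - l i = c - m c := by
    intro c i
    omega
  simp only [dualJacobiTrudi, elemSymm_zero_left, hentry]
  split_ifs with h
  · subst h
    refine (congrArg Matrix.det (Matrix.ext fun c i => ?_)).trans Matrix.det_one
    simp only [Matrix.of_apply, (strictMono_val_sub hl).injective.eq_iff, Matrix.one_apply, eq_comm]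
  · rw [Matrix.det_apply']
    refine Finset.sum_eq_zero fun σ _ => mul_eq_zero_of_right _ ?_
    by_contra hne
    have hσ : (fun i : Fin n => (i : ℤ) - l i) = (fun c : Fin n => (c : ℤ) - m c) ∘ σ :=
      funext fun i => of_not_not fun hi => hne (Finset.prod_eq_zero (Finset.mem_univ i) (if_neg hi))
    have heq := ((strictMono_val_sub hl).range_inj (strictMono_val_sub hm)).1
      (by rw [hσ, σ.surjective.range_comp])
    exact h (funext fun c => by have := congrFun heq c; omega)

end DualJacobiTrudi

/-! ### Tableaux by columns -/

section ColTableau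

variable {n V : ℕ} {l m : Fin n → ℕ}

/-- Fillings of the cells between the column lengths `m` and `l` by numbers smaller than `V`,
weakly increasing along rows and strictly increasing down columns. The entry in column `c` and row
`i` is `f c i`, and it is `0` off the shape. -/
structure IsColTableau (V : ℕ) (l m : Fin n → ℕ) (f : Fin n → ℕ → ℕ) : Prop where
  le : ∀ c, m c ≤ l c
  lt : ∀ c i, m c ≤ i → i < l c → f c i < V
  row : ∀ c₁ c₂ i, c₁ < c₂ → m c₁ ≤ i → i < l c₂ → f c₁ i ≤ f c₂ i
  col : ∀ c i₁ i₂, i₁ < i₂ → m c ≤ i₁ → i₂ < l c → f c i₁ < f c i₂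
  zero : ∀ c i, l c ≤ i ∨ i < m c → f c i = 0

instance : Finite {f // IsColTableau V l m f} := by
  refine Finite.of_injective
    (fun f => (fun c i => Fin.ofNat (V + 1) (f.1 c i) : (c : Fin n) → Fin (l c) → Fin (V + 1))) ?_
  rintro ⟨f, hf⟩ ⟨g, hg⟩ hfg
  refine Subtype.ext (funext fun c => funext fun i => ?_)
  by_cases hi : m c ≤ i ∧ i < l c
  · have hmod := congrArg Fin.val (congrFun (congrFun hfg c) ⟨i, hi.2⟩)
    have hf_lt := hf.lt c i hi.1 hi.2
    have hg_lt := hg.lt c i hi.1 hi.2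
    simp only [Fin.val_ofNat] at hmod
    rwa [Nat.mod_eq_of_lt (by omega), Nat.mod_eq_of_lt (by omega)] at hmod
  · change f c i = g c i
    rw [hf.zero c i (by omega), hg.zero c i (by omega)]

instance : Fintype {f // IsColTableau V l m f} := Fintype.ofFinite _

theorem addCells_of_mem {S : Finset (Fin n)} {c : Fin n} (hc : c ∈ S) :
    addCells m S c = m c + 1 := by
  rw [addCells, if_pos hc]

theorem addCells_of_notMem {S : Finset (Fin n)} {c : Fin n} (hc : c ∉ S) :
    addCells m S c = m c := by
  rw [addCells, if_neg hc, add_zero]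

theorem le_addCells (m : Fin n → ℕ) (S : Finset (Fin n)) (c : Fin n) : m c ≤ addCells m S c :=
  Nat.le_add_right _ _

/-- The columns whose topmost cell contains `0`. -/
def zeroColumns (l m : Fin n → ℕ) (f : Fin n → ℕ → ℕ) : Finset (Fin n) :=
  {c | m c < l c ∧ f c (m c) = 0}

theorem mem_zeroColumns {f : Fin n → ℕ → ℕ} {c : Fin n} :
    c ∈ zeroColumns l m f ↔ m c < l c ∧ f c (m c) = 0 := by
  simp [zeroColumns]

/-- The filling with all entries on the cells between `m` and `l` increased by one, and `0` off
these cells. -/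
def raiseEntries (l m : Fin n → ℕ) (g : Fin n → ℕ → ℕ) (c : Fin n) (i : ℕ) : ℕ :=
  if m c ≤ i ∧ i < l c then g c i + 1 else 0

namespace IsColTableau

variable {f g : Fin n → ℕ → ℕ} {S : Finset (Fin n)}

theorem pos_iff (h : IsColTableau V l m f) {c : Fin n} {i : ℕ} :
    0 < f c i ↔ addCells m (zeroColumns l m f) c ≤ i ∧ i < l c := by
  have hzero := h.zero c i
  have hcol := h.col c (m c) i
  by_cases hc : c ∈ zeroColumns l m f
  · rw [addCells_of_mem hc]
    obtain ⟨-, hc⟩ := mem_zeroColumns.1 hc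
    rcases eq_or_ne i (m c) with rfl | hi <;> omega
  · rw [addCells_of_notMem hc]
    rw [mem_zeroColumns] at hc
    rcases eq_or_ne i (m c) with rfl | hi <;> omega

theorem antitone_addCells_zeroColumns (h : IsColTableau V l m f) (hl : Antitone l)
    (hm : Antitone m) : Antitone (addCells m (zeroColumns l m f)) := by
  intro a b hab
  rcases hab.eq_or_lt with rfl | hlt
  · exact le_rfl
  have hlab := hl hab
  have hmab := hm hab
  have hrow := h.row a b (m b) hlt
  simp only [addCells, mem_zeroColumns]
  by_cases hm_eq : m a = m b
  · rw [hm_eq]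
    split_ifs <;> omega
  · split_ifs <;> omega

theorem lower (h : IsColTableau (V + 1) l m f) :
    IsColTableau V l (addCells m (zeroColumns l m f)) fun c i => f c i - 1 := by
  have hge := le_addCells m (zeroColumns l m f)
  constructor
  · intro c
    have := h.le c
    simp only [addCells, mem_zeroColumns]
    split_ifs <;> omega
  · intro c i hi hil
    have := h.pos_iff.2 ⟨hi, hil⟩
    have := h.lt c i ((hge c).trans hi) hil
    omega
  · intro a b i hab hi hil
    exact Nat.sub_le_sub_right (h.row a b i hab ((hge a).trans hi) hil) 1
  · intro c i₁ i₂ hlt hi hil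
    have := h.pos_iff.2 ⟨hi, hlt.trans hil⟩
    have := h.col c i₁ i₂ hlt ((hge c).trans hi) hil
    omega
  · intro c i hi
    have := (h.pos_iff (c := c) (i := i)).1
    omega

theorem raise (hS : Antitone (addCells m S)) (h : IsColTableau V l (addCells m S) g) :
    IsColTableau (V + 1) l m (raiseEntries l (addCells m S) g) := by
  have hge := le_addCells m S
  have hle : ∀ c, addCells m S c ≤ m c + 1 := fun c => by
    unfold addCells
    split_ifs <;> omega
  constructor
  · exact fun c => (hge c).trans (h.le c)
  · intro c i _ _
    unfold raiseEntries
    split_ifs with hcell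
    · exact Nat.succ_lt_succ (h.lt c i hcell.1 hcell.2)
    · omega
  · intro a b i hab _ hil
    have := hS hab.le
    unfold raiseEntries
    split_ifs with ha hb hb
    · exact Nat.succ_le_succ (h.row a b i hab ha.1 hil)
    all_goals omega
  · intro c i₁ i₂ hlt hi hil
    have := hle c
    unfold raiseEntries
    rw [if_pos (c := _ ∧ i₂ < l c) ⟨by omega, hil⟩]
    split_ifs with hcell
    · exact Nat.succ_lt_succ (h.col c i₁ i₂ hlt hcell.1 hil)
    · omega
  · intro c i hi
    have := hge c
    unfold raiseEntries
    rw [if_neg (by omega)]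

theorem zeroColumns_raiseEntries (h : IsColTableau V l (addCells m S) g) :
    zeroColumns l m (raiseEntries l (addCells m S) g) = S := by
  ext c
  have hle := h.le c
  rw [mem_zeroColumns]
  unfold raiseEntries
  by_cases hc : c ∈ S
  · rw [addCells_of_mem hc] at hle ⊢
    exact iff_of_true ⟨by omega, if_neg (by omega)⟩ hc
  · rw [addCells_of_notMem hc]
    refine iff_of_false (fun ⟨hlt, hzero⟩ => ?_) hc
    rw [if_pos ⟨le_rfl, hlt⟩] at hzero
    omega

theorem raiseEntries_sub_one (h : IsColTableau V l m f) :
    (raiseEntries l (addCells m (zeroColumns l m f)) fun c i => f c i - 1) = f := by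
  funext c i
  have := h.pos_iff (c := c) (i := i)
  simp only [raiseEntries]
  split_ifs <;> omega

theorem sub_one_raiseEntries (h : IsColTableau V l m g) :
    (fun c i => raiseEntries l m g c i - 1) = g := by
  funext c i
  unfold raiseEntries
  split_ifs with hcell
  · rfl
  · rw [h.zero c i (by omega)]

end IsColTableau

/-- Removing the cells that contain `0`, at most one in each column, and lowering all other entries
by one. -/
def colTableauSuccEquiv (hl : Antitone l) (hm : Antitone m) :
    {f // IsColTableau (V + 1) l m f} ≃
      Σ S : {S : Finset (Fin n) // Antitone (addCells m S)},
        {g // IsColTableau V l (addCells m S.1) g} where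
  toFun f := ⟨⟨zeroColumns l m f.1, f.2.antitone_addCells_zeroColumns hl hm⟩,
    ⟨fun c i => f.1 c i - 1, f.2.lower⟩⟩
  invFun p := ⟨raiseEntries l (addCells m p.1.1) p.2.1, p.2.2.raise p.1.2⟩
  left_inv f := Subtype.ext f.2.raiseEntries_sub_one
  right_inv := by
    rintro ⟨⟨S, hS⟩, ⟨g, hg : IsColTableau V l (addCells m S) g⟩⟩
    refine Sigma.ext (Subtype.ext hg.zeroColumns_raiseEntries) ?_
    dsimp only
    rw [Subtype.heq_iff_coe_eq fun f => by rw [hg.zeroColumns_raiseEntries]]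
    exact hg.sub_one_raiseEntries

/-- The product of the variables indexed by the entries of a filling given by columns. -/
def colWeight {M : Type*} [CommMonoid M] (x : ℕ → M) (l m : Fin n → ℕ) (f : Fin n → ℕ → ℕ) : M :=
  ∏ c, ∏ i ∈ Finset.Ico (m c) (l c), x (f c i)

theorem colWeight_raiseEntries {M : Type*} [CommMonoid M] (x : ℕ → M) {S : Finset (Fin n)}
    {g : Fin n → ℕ → ℕ} (h : IsColTableau V l (addCells m S) g) :
    colWeight x l m (raiseEntries l (addCells m S) g) =
      x 0 ^ S.card * colWeight (fun i => x (i + 1)) l (addCells m S) g := by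
  have hzeros : x 0 ^ S.card = ∏ c : Fin n, if c ∈ S then x 0 else 1 := by
    rw [Finset.prod_ite_mem, Finset.univ_inter, Finset.prod_const]
  rw [hzeros, colWeight, colWeight, ← Finset.prod_mul_distrib]
  refine Finset.prod_congr rfl fun c _ => ?_
  have hraised : ∏ i ∈ Finset.Ico (addCells m S c) (l c), x (g c i + 1) =
      ∏ i ∈ Finset.Ico (addCells m S c) (l c), x (raiseEntries l (addCells m S) g c i) := by
    refine Finset.prod_congr rfl fun i hi => ?_
    rw [raiseEntries, if_pos (Finset.mem_Ico.1 hi)]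
  have hle := h.le c
  rw [hraised]
  by_cases hc : c ∈ S
  · rw [addCells_of_mem hc] at hle
    rw [if_pos hc, Finset.prod_eq_prod_Ico_succ_bot hle, raiseEntries, addCells_of_mem hc,
      if_neg (by omega)]
  · rw [if_neg hc, one_mul, addCells_of_notMem hc]

theorem isColTableau_zero_iff {f : Fin n → ℕ → ℕ} : IsColTableau 0 l m f ↔ l = m ∧ f = 0 := by
  constructor
  · intro h
    have hlm : l = m := funext fun c => by
      have hle := h.le c
      have hlt := h.lt c (m c) le_rfl
      omega
    exact ⟨hlm, funext fun c => funext fun i => h.zero c i (by rw [hlm]; omega)⟩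
  · rintro ⟨rfl, rfl⟩
    constructor <;> intros <;> first | rfl | omega

variable {R : Type*} [CommRing R]

theorem sum_colWeight_zero (x : ℕ → R) (l m : Fin n → ℕ) :
    ∑ f : {f // IsColTableau 0 l m f}, colWeight x l m f = if l = m then 1 else 0 := by
  split_ifs with hlm
  · subst hlm
    have : Unique {f // IsColTableau 0 l l f} :=
      ⟨⟨⟨0, isColTableau_zero_iff.2 ⟨rfl, rfl⟩⟩⟩,
        fun f => Subtype.ext (isColTableau_zero_iff.1 f.2).2⟩
    rw [Fintype.sum_unique]
    simp [colWeight]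
  · have : IsEmpty {f // IsColTableau 0 l m f} := ⟨fun f => hlm (isColTableau_zero_iff.1 f.2).1⟩
    exact Fintype.sum_empty _

theorem sum_colWeight_succ (x : ℕ → R) (hl : Antitone l) (hm : Antitone m) :
    ∑ f : {f // IsColTableau (V + 1) l m f}, colWeight x l m f =
      ∑ S : {S : Finset (Fin n) // Antitone (addCells m S)}, x 0 ^ S.1.card *
        ∑ g : {g // IsColTableau V l (addCells m S) g},
          colWeight (fun i => x (i + 1)) l (addCells m S) g := by
  rw [← (colTableauSuccEquiv hl hm).symm.sum_comp, Fintype.sum_sigma]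
  refine Finset.sum_congr rfl fun S _ => ?_
  rw [Finset.mul_sum]
  exact Finset.sum_congr rfl fun g _ => colWeight_raiseEntries x g.2

theorem sum_colWeight (x : ℕ → R) (V : ℕ) (hl : Antitone l) (hm : Antitone m) :
    ∑ f : {f // IsColTableau V l m f}, colWeight x l m f =
      dualJacobiTrudi ((Multiset.range V).map x) l m := by
  induction V generalizing x m with
  | zero => rw [sum_colWeight_zero, Multiset.range_zero, Multiset.map_zero,
      dualJacobiTrudi_zero hl hm]
  | succ V ih =>
    have hcons : (Multiset.range (V + 1)).map x =
        x 0 ::ₘ (Multiset.range V).map fun i => x (i + 1) := by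
      simp [Multiset.range, List.range_succ_eq_map, Function.comp_def]
    rw [sum_colWeight_succ x hl hm, hcons, dualJacobiTrudi_cons]
    simp only [fun S : {S : Finset (Fin n) // Antitone (addCells m S)} =>
      ih (fun i => x (i + 1)) S.2]
    rw [← Finset.sum_subtype {S : Finset (Fin n) | Antitone (addCells m S)} (by simp)
      (fun S => x 0 ^ S.card *
        dualJacobiTrudi ((Multiset.range V).map fun i => x (i + 1)) l (addCells m S))]
    refine Finset.sum_subset (Finset.filter_subset _ _) fun S _ hS => ?_
    rw [dualJacobiTrudi_addCells_eq_zero _ l hm (by simpa using hS), mul_zero]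

end ColTableau

/-! ### Skew Schur functions -/

section SkewTableau

variable {lam mu : YoungDiagram} {n V : ℕ}

/-- The first `n` column lengths of a Young diagram. -/
def colLengths (lam : YoungDiagram) (n : ℕ) (c : Fin n) : ℕ := lam.colLen c

theorem antitone_colLengths (lam : YoungDiagram) (n : ℕ) : Antitone (colLengths lam n) :=
  fun _ _ h => lam.colLen_anti _ _ h

theorem mem_iff_lt_colLengths {i : ℕ} {c : Fin n} : (i, (c : ℕ)) ∈ lam ↔ i < colLengths lam n c :=
  YoungDiagram.mem_iff_lt_colLen

theorem notMem_iff_colLengths_le {i : ℕ} {c : Fin n} :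
    (i, (c : ℕ)) ∉ lam ↔ colLengths lam n c ≤ i :=
  mem_iff_lt_colLengths.not.trans not_lt

/-- The entries of `T` are smaller than `V`. -/
def SkewTableau.EntriesLT (V : ℕ) (T : SkewTableau lam mu) : Prop :=
  ∀ i c, (i, c) ∈ lam → (i, c) ∉ mu → T.entry i c < V

theorem SkewTableau.EntriesLT.isColTableau {T : SkewTableau lam mu} (hT : T.EntriesLT V) (n : ℕ) :
    IsColTableau V (colLengths lam n) (colLengths mu n) fun c i => T.entry i c where
  le _ := le_of_forall_lt fun _ hi =>
    mem_iff_lt_colLengths.1 (T.contained (mem_iff_lt_colLengths.2 hi))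
  lt _ _ hi hil := hT _ _ (mem_iff_lt_colLengths.2 hil) (notMem_iff_colLengths_le.2 hi)
  row _ _ _ hab hi hil :=
    T.row_weak hab (notMem_iff_colLengths_le.2 hi) (mem_iff_lt_colLengths.2 hil)
  col _ _ _ hlt hi hil :=
    T.col_strict hlt (notMem_iff_colLengths_le.2 hi) (mem_iff_lt_colLengths.2 hil)
  zero _ _ hi := T.zeros (hi.imp notMem_iff_colLengths_le.2 mem_iff_lt_colLengths.2)

/-- The skew tableau with the given columns. -/
def IsColTableau.toSkewTableau {f : Fin n → ℕ → ℕ}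
    (hf : IsColTableau V (colLengths lam n) (colLengths mu n) f) (hmu : mu ≤ lam)
    (hn : ∀ i c, (i, c) ∈ lam → c < n) : SkewTableau lam mu where
  entry i c := if h : c < n then f ⟨c, h⟩ i else 0
  contained := hmu
  row_weak {i a b} hab ha hb := by
    have hbn := hn _ _ hb
    rw [dif_pos hbn, dif_pos (hab.trans hbn)]
    exact hf.row ⟨a, _⟩ ⟨b, hbn⟩ i hab (notMem_iff_colLengths_le.1 ha) (mem_iff_lt_colLengths.1 hb)
  col_strict {i₁ i₂ c} hlt hi₁ hi₂ := by
    have hc := hn _ _ hi₂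
    rw [dif_pos hc, dif_pos hc]
    exact hf.col ⟨c, hc⟩ _ _ hlt (notMem_iff_colLengths_le.1 hi₁) (mem_iff_lt_colLengths.1 hi₂)
  zeros {i c} hi := by
    split_ifs with hc
    · exact hf.zero ⟨c, hc⟩ i (hi.imp notMem_iff_colLengths_le.1 mem_iff_lt_colLengths.1)
    · rfl

theorem IsColTableau.entriesLT_toSkewTableau {f : Fin n → ℕ → ℕ}
    (hf : IsColTableau V (colLengths lam n) (colLengths mu n) f) (hmu : mu ≤ lam)
    (hn : ∀ i c, (i, c) ∈ lam → c < n) : (hf.toSkewTableau hmu hn).EntriesLT V := by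
  intro i c hlam hmu
  have hc := hn _ _ hlam
  dsimp only [toSkewTableau]
  rw [dif_pos hc]
  exact hf.lt ⟨c, hc⟩ i (notMem_iff_colLengths_le.1 hmu) (mem_iff_lt_colLengths.1 hlam)

/-- A skew tableau whose shape has at most `n` columns is given by its columns. -/
def skewTableauEquiv (V : ℕ) (hmu : mu ≤ lam) (hn : ∀ i c, (i, c) ∈ lam → c < n) :
    {T : SkewTableau lam mu // T.EntriesLT V} ≃
      {f // IsColTableau V (colLengths lam n) (colLengths mu n) f} where
  toFun T := ⟨fun c i => T.1.entry i c, T.2.isColTableau n⟩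
  invFun f := ⟨f.2.toSkewTableau hmu hn, f.2.entriesLT_toSkewTableau hmu hn⟩
  left_inv T := by
    refine Subtype.ext (SkewTableau.ext (funext fun i => funext fun c => ?_))
    dsimp only [IsColTableau.toSkewTableau]
    split_ifs with hc
    · rfl
    · exact (T.1.zeros (Or.inl fun h => hc (hn _ _ h))).symm
  right_inv f := by
    refine Subtype.ext (funext fun c => funext fun i => ?_)
    dsimp only [IsColTableau.toSkewTableau]
    rw [dif_pos c.2]

theorem SkewTableau.weight_eq_colWeight (hn : ∀ i c, (i, c) ∈ lam → c < n) (x : ℕ → ℝ)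
    (T : SkewTableau lam mu) :
    T.weight x = colWeight x (colLengths lam n) (colLengths mu n) fun c i => T.entry i c := by
  rw [SkewTableau.weight, colWeight, Finset.prod_sigma', eq_comm]
  refine Finset.prod_bij (fun p _ => (p.2, (p.1 : ℕ))) ?_ ?_ ?_ fun _ _ => rfl
  · rintro ⟨c, i⟩ hi
    simp only [Finset.mem_sigma, Finset.mem_univ, Finset.mem_Ico, true_and] at hi
    exact Finset.mem_sdiff.2 ⟨mem_iff_lt_colLengths.2 hi.2, notMem_iff_colLengths_le.2 hi.1⟩
  · rintro ⟨c, i⟩ _ ⟨c', i'⟩ _ h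
    simp only [Prod.mk.injEq] at h
    obtain ⟨rfl, hc⟩ := h
    obtain rfl := Fin.ext hc
    rfl
  · rintro ⟨i, c⟩ hic
    obtain ⟨hlam, hmu⟩ := Finset.mem_sdiff.1 hic
    refine ⟨⟨⟨c, hn _ _ hlam⟩, i⟩, ?_, rfl⟩
    simp only [Finset.mem_sigma, Finset.mem_univ, Finset.mem_Ico, true_and]
    exact ⟨notMem_iff_colLengths_le.1 hmu, mem_iff_lt_colLengths.1 hlam⟩

theorem finite_setOf_entriesLT (V : ℕ) (hmu : mu ≤ lam) (hn : ∀ i c, (i, c) ∈ lam → c < n) :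
    {T : SkewTableau lam mu | T.EntriesLT V}.Finite :=
  Set.finite_coe_iff.1 (Finite.of_equiv _ (skewTableauEquiv V hmu hn).symm)

theorem sum_weight_entriesLT (V : ℕ) (hmu : mu ≤ lam) (hn : ∀ i c, (i, c) ∈ lam → c < n)
    (x : ℕ → ℝ) :
    ∑ T ∈ (finite_setOf_entriesLT V hmu hn).toFinset, T.weight x =
      dualJacobiTrudi ((Multiset.range V).map x) (colLengths lam n) (colLengths mu n) := by
  have : Fintype {T : SkewTableau lam mu // T.EntriesLT V} :=
    (finite_setOf_entriesLT V hmu hn).fintype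
  rw [← sum_colWeight x V (antitone_colLengths lam n) (antitone_colLengths mu n),
    ← (skewTableauEquiv V hmu hn).sum_comp,
    Finset.sum_subtype _ (p := fun T : SkewTableau lam mu => T.EntriesLT V) (by simp)]
  exact Finset.sum_congr rfl fun T _ => T.1.weight_eq_colWeight hn x

theorem SkewTableau.entriesLT_sup_add_one (T : SkewTableau lam mu) :
    T.EntriesLT ((lam.cells.sup fun c => T.entry c.1 c.2) + 1) := fun i c hic _ =>
  Nat.lt_succ_of_le (Finset.le_sup (f := fun c : ℕ × ℕ => T.entry c.1 c.2) (b := (i, c)) hic)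

theorem tendsto_entriesLT_atTop (hmu : mu ≤ lam) (hn : ∀ i c, (i, c) ∈ lam → c < n) :
    Tendsto (fun V => (finite_setOf_entriesLT (mu := mu) V hmu hn).toFinset) atTop atTop := by
  refine tendsto_atTop_finset_of_monotone (fun V W hVW => ?_) fun T =>
    ⟨_, (Set.Finite.mem_toFinset _).2 T.entriesLT_sup_add_one⟩
  exact Set.Finite.toFinset_subset_toFinset.2 fun T hT i c hlam hmu =>
    (hT i c hlam hmu).trans_le hVW

theorem SkewTableau.abs_weight (x : ℕ → ℝ) (T : SkewTableau lam mu) :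
    |T.weight x| = T.weight fun i => |x i| :=
  Finset.abs_prod _ _

theorem hasSum_weight_of_tendsto (hmu : mu ≤ lam) (hn : ∀ i c, (i, c) ∈ lam → c < n) {x : ℕ → ℝ}
    {a b : ℝ}
    (habs : Tendsto (fun V => dualJacobiTrudi ((Multiset.range V).map fun i => |x i|)
      (colLengths lam n) (colLengths mu n)) atTop (𝓝 a))
    (h : Tendsto (fun V => dualJacobiTrudi ((Multiset.range V).map x)
      (colLengths lam n) (colLengths mu n)) atTop (𝓝 b)) :
    HasSum (fun T : SkewTableau lam mu => T.weight x) b := by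
  have hexhaust := tendsto_entriesLT_atTop hmu hn
  obtain ⟨B, hB⟩ := habs.bddAbove_range
  have hbound : ∀ u : Finset (SkewTableau lam mu), ∑ T ∈ u, |T.weight x| ≤ B := by
    intro u
    obtain ⟨V, hV⟩ := (hexhaust.eventually (eventually_ge_atTop u)).exists
    calc ∑ T ∈ u, |T.weight x|
        ≤ ∑ T ∈ (finite_setOf_entriesLT V hmu hn).toFinset, |T.weight x| :=
          Finset.sum_le_sum_of_subset_of_nonneg hV fun T _ _ => abs_nonneg _
      _ = dualJacobiTrudi ((Multiset.range V).map fun i => |x i|)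
            (colLengths lam n) (colLengths mu n) := by
          simp only [SkewTableau.abs_weight]
          exact sum_weight_entriesLT V hmu hn _
      _ ≤ B := hB ⟨V, rfl⟩
  have hsum := (summable_of_sum_le (fun _ => abs_nonneg _) hbound).of_abs.hasSum
  have hlim := (hsum.comp hexhaust).congr fun V => sum_weight_entriesLT V hmu hn x
  rwa [tendsto_nhds_unique h hlim]

end SkewTableau

/-! ### The principal specialization -/

section PrincipalSpecialization

variable {q : ℝ}

theorem summable_norm_neg_pow_succ (hq : |q| < 1) : Summable fun i : ℕ => ‖-q ^ (i + 1)‖ := by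
  simp only [norm_neg, norm_pow, Real.norm_eq_abs]
  exact (summable_nat_add_iff 1).2 (summable_geometric_of_lt_one (abs_nonneg q) hq)

theorem tendsto_qPoch (hq : |q| < 1) : Tendsto (qPoch q) atTop (𝓝 (qPochInf q)) := by
  have hmul : Multipliable fun i : ℕ => 1 - q ^ (i + 1) := by
    simpa only [sub_eq_add_neg] using
      multipliable_one_add_of_summable (summable_norm_neg_pow_succ hq)
  refine hmul.hasProd.tendsto_prod_nat.congr fun n => ?_
  induction n with
  | zero => rw [Finset.prod_range_zero, qPoch_zero]
  | succ n ih => rw [Finset.prod_range_succ, ih, qPoch_succ]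

theorem qPochInf_ne_zero (hq : |q| < 1) : qPochInf q ≠ 0 := by
  have := tprod_one_add_ne_zero_of_summable (f := fun i : ℕ => -q ^ (i + 1))
    (fun i => by simpa only [sub_eq_add_neg] using one_sub_pow_ne_zero hq.ne i)
    (summable_norm_neg_pow_succ hq)
  simpa only [qPochInf, sub_eq_add_neg] using this

theorem tendsto_qBinom_left (hq : |q| < 1) (k : ℕ) :
    Tendsto (fun n => qBinom q n k) atTop (𝓝 (1 / qPoch q k)) := by
  have hk := qPoch_ne_zero hq.ne k
  have hinf := qPochInf_ne_zero hq
  have hlim := ((tendsto_add_atTop_iff_nat k).2 (tendsto_qPoch hq)).div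
    ((tendsto_qPoch hq).const_mul (qPoch q k)) (mul_ne_zero hk hinf)
  rw [← tendsto_add_atTop_iff_nat k]
  convert hlim using 2
  · exact qBinom_add hq.ne _ k
  · field_simp

theorem esymm_geometric (hq : |q| ≠ 1) {V m : ℕ} (hm : m ≤ V) :
    ((Multiset.range V).map fun i => q ^ i).esymm m = q ^ m.choose 2 * qBinom q V m := by
  obtain ⟨r, rfl⟩ := Nat.exists_eq_add_of_le' hm
  have hprod : (((Multiset.range (r + m)).map fun i => q ^ i).map
      fun a => Polynomial.X + Polynomial.C a).prod = qShiftedPow q 1 (r + m) := by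
    simp only [Multiset.map_map, qShiftedPow, one_mul]
    rfl
  have hcoeff := Multiset.prod_X_add_C_coeff ((Multiset.range (r + m)).map fun i => q ^ i)
    (k := r) (by simp)
  rw [hprod, coeff_qShiftedPow hq, Multiset.card_map, Multiset.card_range, Nat.add_sub_cancel_left,
    one_pow, one_mul] at hcoeff
  rw [← hcoeff, qBinom_symm_add hq]

theorem tendsto_elemSymm_geometric (hq : |q| < 1) (z : ℤ) :
    Tendsto (fun V => elemSymm ((Multiset.range V).map fun i => q ^ i) z) atTop
      (𝓝 (qElem q z)) := by
  rcases lt_or_ge z 0 with hz | hz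
  · simp only [elemSymm_of_neg _ hz, qElem_of_neg q hz, tendsto_const_nhds]
  · obtain ⟨m, rfl⟩ := Int.eq_ofNat_of_zero_le hz
    rw [qElem_natCast, ← mul_one_div]
    refine ((tendsto_qBinom_left hq m).const_mul _).congr' ?_
    filter_upwards [eventually_ge_atTop m] with V hV
    rw [elemSymm_natCast, esymm_geometric hq.ne hV]

theorem hasSum_weight_geometric (hq : |q| < 1) {lam mu : YoungDiagram} {n : ℕ} (hmu : mu ≤ lam)
    (hn : ∀ i c, (i, c) ∈ lam → c < n) :
    HasSum (fun T : SkewTableau lam mu => T.weight fun i => q ^ i)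
      (Matrix.of fun c i : Fin n =>
        qElem q ((colLengths lam n i : ℤ) - i - colLengths mu n c + c)).det := by
  have hlim : ∀ p : ℝ, |p| < 1 →
      Tendsto (fun V => dualJacobiTrudi ((Multiset.range V).map fun i => p ^ i)
        (colLengths lam n) (colLengths mu n)) atTop
        (𝓝 (Matrix.of fun c i : Fin n =>
          qElem p ((colLengths lam n i : ℤ) - i - colLengths mu n c + c)).det) := by
    intro p hp
    refine (continuous_id.matrix_det.tendsto _).comp ?_
    exact tendsto_pi_nhds.2 fun c => tendsto_pi_nhds.2 fun i => tendsto_elemSymm_geometric hp _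
  have habs := hlim |q| (by rwa [abs_abs])
  simp only [← abs_pow] at habs
  exact hasSum_weight_of_tendsto hmu hn habs (hlim q hq)

end PrincipalSpecialization

/-! ### The closed form -/

section ClosedForm

theorem mem_rectAddRow {d N j i c : ℕ} :
    (i, c) ∈ rectAddRow d N j ↔ (i < d ∧ c < N) ∨ (i < d + 1 ∧ c < j) := by
  rw [rectAddRow, YoungDiagram.mem_sup, mem_rectDiagram, mem_rectDiagram]

theorem colLengths_rectAddRow {d N j : ℕ} (c : Fin N) :
    colLengths (rectAddRow d N j) N c = if (c : ℕ) < j then d + 1 else d := by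
  refine eq_of_forall_lt_iff fun i => ?_
  rw [← mem_iff_lt_colLengths, mem_rectAddRow]
  have := c.2
  split_ifs <;> omega

theorem colLengths_oneRow {k N : ℕ} (c : Fin N) :
    colLengths (oneRow k) N c = if (c : ℕ) < k then 1 else 0 := by
  refine eq_of_forall_lt_iff fun i => ?_
  rw [← mem_iff_lt_colLengths, oneRow, mem_rectDiagram]
  split_ifs <;> omega

theorem oneRow_le_rectAddRow {d N k : ℕ} (hd : 1 ≤ d) (hk : k ≤ N) (j : ℕ) :
    oneRow k ≤ rectAddRow d N j := by
  rintro ⟨i, c⟩ hic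
  have := mem_rectDiagram.1 (show (i, c) ∈ rectDiagram 1 k from hic)
  exact mem_rectAddRow.2 (by omega)

variable {q : ℝ}

theorem hasSum_weight_rectAddRow (hq0 : q ≠ 0) (hq : |q| < 1) {d N j k : ℕ} (hd : 1 ≤ d)
    (hj : j ≤ N) (hk : k ≤ N) :
    HasSum (fun T : SkewTableau (rectAddRow d N j) (oneRow k) => T.weight fun i => q ^ i)
      ((q ^ d.choose 2) ^ N * (∏ b ∈ Finset.range (N + 1), qPoch q b / qPoch q (d + b)) *
        ((q ^ d) ^ j / (q ^ j * (q ^ d) ^ k)) * (qPoch q (d + k) / qPoch q j) *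
        hookSum q d j k (N + 1 - j)) := by
  have hsum := hasSum_weight_geometric hq (oneRow_le_rectAddRow hd hk j)
    (n := N) (fun i c hic => by rw [mem_rectAddRow] at hic; omega)
  simp only [colLengths_rectAddRow, colLengths_oneRow] at hsum
  rw [← det_elemToeplitz_submatrix hq0 hq.ne d N ⟨j, by omega⟩ ⟨k, by omega⟩,
    ← Matrix.det_transpose]
  convert hsum using 1
  refine congrArg Matrix.det (Matrix.ext fun c i => ?_)
  simp only [Matrix.transpose_apply, Matrix.submatrix_apply, elemToeplitz, Matrix.of_apply,
    Fin.succAbove, Fin.lt_def, Fin.val_castSucc]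
  congr 1
  split_ifs <;> simp only [Fin.val_succ, Fin.val_castSucc] <;> push_cast <;> ring

theorem prod_range_pow_eq_pow_choose_two {M : Type*} [CommMonoid M] (a : M) (n : ℕ) :
    ∏ i ∈ Finset.range n, a ^ i = a ^ n.choose 2 := by
  rw [Finset.prod_pow_eq_pow_sum, Finset.sum_range_id, Nat.choose_two_right]

theorem qBarnes_succ (q : ℝ) (n : ℕ) :
    qBarnes q (n + 1) = (∏ i ∈ Finset.range n, qPoch q i) / (1 - q) ^ n.choose 2 := by
  have hrange : qBarnes q (n + 1) = ∏ i ∈ Finset.range n, qGamma q (i + 1) := by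
    rcases n with _ | n
    · simp [qBarnes]
    · rw [qBarnes, Finset.prod_range_eq_mul_Ico _ n.succ_pos]
      simp [qGamma, qPoch_zero]
  rw [hrange, ← prod_range_pow_eq_pow_choose_two, ← Finset.prod_div_distrib]
  rfl

theorem prod_qPoch_ne_zero (hq : |q| ≠ 1) {ι : Type*} (s : Finset ι) (f : ι → ℕ) :
    ∏ i ∈ s, qPoch q (f i) ≠ 0 :=
  Finset.prod_ne_zero_iff.2 fun _ _ => qPoch_ne_zero hq _

theorem qBarnes_div (hq : |q| ≠ 1) (d N : ℕ) :
    qBarnes q (N + 2) * qBarnes q (d + 1) / qBarnes q (d + N + 2) / (1 - q) ^ (d * (N + 1)) =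
      ∏ b ∈ Finset.range (N + 1), qPoch q b / qPoch q (d + b) := by
  have hq1 : 1 - q ≠ 0 := by simpa using one_sub_pow_ne_zero hq 0
  have hd := prod_qPoch_ne_zero hq (Finset.range d) id
  have hN := prod_qPoch_ne_zero hq (Finset.range (N + 1)) (d + ·)
  dsimp only [id] at hd
  rw [show d + N + 2 = d + (N + 1) + 1 by ring, qBarnes_succ, qBarnes_succ, qBarnes_succ,
    Finset.prod_range_add _ d (N + 1), choose_two_add d (N + 1), Finset.prod_div_distrib]
  field_simp
  ring

theorem mul_sub_one_ediv_two (d : ℕ) : (d : ℤ) * (d - 1) / 2 = d.choose 2 := by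
  cases d <;> simp [Nat.choose_two_right]

theorem hookSum_eq_sum_Icc (hq : |q| ≠ 1) (d j k N : ℕ) :
    hookSum q d j k (N + 1 - j) =
      ∑ r ∈ Finset.Icc (max j k) N,
        q ^ r * qBinom q r (r - k) * qBinom q (d + r - j - 1) (r - j) := by
  have hIco : hookSum q d j k (N + 1 - j) =
      ∑ r ∈ Finset.Ico j (N + 1), q ^ r * qBinom q r k * qHomog q d (r - j) := by
    simp only [hookSum, Finset.sum_Ico_eq_sum_range, Nat.add_sub_cancel_left]
  rw [hIco, eq_comm]
  refine Finset.sum_subset_zero_on_sdiff (fun r hr => ?_) (fun r hr => ?_) fun r hr => ?_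
  · rw [Finset.mem_Icc] at hr
    exact Finset.mem_Ico.2 (by omega)
  · simp only [Finset.mem_sdiff, Finset.mem_Ico, Finset.mem_Icc, max_le_iff] at hr
    rw [qBinom_of_lt (by omega), mul_zero, zero_mul]
  · rw [Finset.mem_Icc, max_le_iff] at hr
    obtain ⟨s, rfl⟩ := Nat.exists_eq_add_of_le hr.1.2
    rw [qHomog, Nat.add_sub_cancel_left, qBinom_symm_add hq, Nat.add_sub_assoc hr.1.1]

theorem hasSum_weight_rectAddRow_closed_form (hq0 : q ≠ 0) (hq : |q| < 1) {d N j k : ℕ}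
    (hd : 1 ≤ d) (hj : j ≤ N) (hk : k ≤ N) :
    HasSum (fun T : SkewTableau (rectAddRow d N j) (oneRow k) => T.weight fun i => q ^ i)
      (q ^ (((d : ℤ) - 1) * j - d * k + (d : ℤ) * (d - 1) / 2 * N) / (1 - q) ^ (d * (N + 1)) *
          (qBarnes q (N + 2) * qBarnes q (d + 1) / qBarnes q (d + N + 2)) *
          (qPoch q (d + k) / qPoch q j) *
          ∑ r ∈ Finset.Icc (max j k) N,
            q ^ r * qBinom q r (r - k) * qBinom q (d + r - j - 1) (r - j)) := by
  convert! hasSum_weight_rectAddRow hq0 hq hd hj hk using 1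
  have hpow : q ^ (((d : ℤ) - 1) * j - d * k + (d.choose 2 : ℕ) * N) =
      (q ^ d.choose 2) ^ N * ((q ^ d) ^ j / (q ^ j * (q ^ d) ^ k)) := by
    rw [zpow_add₀ hq0, zpow_sub₀ hq0, sub_mul, zpow_sub₀ hq0, one_mul]
    simp only [← Nat.cast_mul, zpow_natCast, pow_mul]
    ring
  rw [hookSum_eq_sum_Icc hq.ne, ← qBarnes_div hq.ne, mul_sub_one_ediv_two, hpow]
  ring

end ClosedForm

/-! ### The asymptotics -/

section Asymptotic

variable {q : ℝ}

theorem qHomog_succ_mul (hq : |q| ≠ 1) (d n : ℕ) :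
    qHomog q d (n + 1) * (1 - q ^ (n + 1)) = (1 - q ^ (d + n)) * qHomog q d n := by
  cases d with
  | zero => cases n <;> simp [qHomog_zero_succ]
  | succ d =>
    rw [qHomog_succ_left, qHomog_succ_left, ← add_assoc, qBinom_succ_succ_mul hq,
      add_right_comm d n 1]

/-- The boundary term in the telescoping summation of `hookSum`. -/
def hookBoundary (q : ℝ) (d j k n : ℕ) : ℝ :=
  qBinom q (j + n) k * qHomog q d n * (q ^ j * (q ^ k - q ^ n))

theorem hookSum_succ (q : ℝ) (d j k n : ℕ) :
    hookSum q d j k (n + 1) =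
      hookSum q d j k n + q ^ (j + n) * qBinom q (j + n) k * qHomog q d n :=
  Finset.sum_range_succ _ n

theorem one_sub_pow_mul_hookSum_zero_right (hq : |q| ≠ 1) (d j n : ℕ) :
    (1 - q ^ d) * hookSum q d j 0 n = hookBoundary q d j 0 n := by
  induction n with
  | zero => simp [hookSum, hookBoundary]
  | succ n ih =>
    rw [hookSum_succ, mul_add, ih]
    simp only [hookBoundary, qBinom_zero_right hq]
    linear_combination -q ^ j * qHomog_succ_mul hq d n

theorem one_sub_pow_mul_hookSum_zero_left (hq : |q| ≠ 1) (d k n : ℕ) :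
    (1 - q ^ (d + k)) * hookSum q d 0 k n = hookBoundary q d 0 k n := by
  induction n with
  | zero => cases k <;> simp [hookSum, hookBoundary, qBinom_of_lt]
  | succ n ih =>
    rw [hookSum_succ, mul_add, ih]
    simp only [hookBoundary, zero_add, pow_zero, one_mul]
    linear_combination -q ^ k * qBinom q n k * qHomog_succ_mul hq d n -
      qHomog q d (n + 1) * qBinom_succ_mul_sub hq n k

theorem one_sub_pow_mul_hookSum_succ_succ (hq : |q| ≠ 1) (d j k n : ℕ) :
    (1 - q ^ (d + k + 1)) * hookSum q d (j + 1) (k + 1) n =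
      q * (1 - q ^ (j + 1)) * hookSum q d j k (n + 1) + hookBoundary q d (j + 1) (k + 1) n := by
  induction n with
  | zero =>
    simp only [hookSum, hookBoundary, Finset.sum_range_succ, Finset.sum_range_zero, add_zero,
      qHomog_zero_right hq]
    linear_combination q ^ (j + 1) * qBinom_succ_succ_mul hq j k
  | succ n ih =>
    rw [hookSum_succ, hookSum_succ _ _ _ _ (n + 1), mul_add, ih]
    simp only [hookBoundary, show j + (n + 1) = j + 1 + n by ring,
      show j + 1 + (n + 1) = j + 1 + n + 1 by ring]
    linear_combination
      -q ^ (j + 1) * q ^ (k + 1) * qBinom q (j + 1 + n) (k + 1) * qHomog_succ_mul hq d n -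
      q ^ (j + 1) * qHomog q d (n + 1) * ((1 - q ^ (n + 1)) * qBinom_succ_succ hq (j + 1 + n) k -
        qBinom_succ_succ_mul hq (j + 1 + n) k)

theorem tendsto_qHomog (hq : |q| < 1) (d : ℕ) :
    Tendsto (qHomog q (d + 1)) atTop (𝓝 (1 / qPoch q d)) := by
  refine ((tendsto_add_atTop_iff_nat d).2 (tendsto_qBinom_left hq d)).congr fun n => ?_
  rw [qHomog_succ_left, add_comm, qBinom_symm_add hq.ne]

theorem tendsto_hookBoundary (hq : |q| < 1) (d j k : ℕ) :
    Tendsto (hookBoundary q (d + 1) j k) atTop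
      (𝓝 (1 / qPoch q k * (1 / qPoch q d) * q ^ (j + k))) := by
  have hbinom : Tendsto (fun n => qBinom q (j + n) k) atTop (𝓝 (1 / qPoch q k)) := by
    simpa only [add_comm j] using (tendsto_add_atTop_iff_nat j).2 (tendsto_qBinom_left hq k)
  have hpow := ((tendsto_pow_atTop_nhds_zero_of_abs_lt_one hq).const_sub (q ^ k)).const_mul (q ^ j)
  rw [sub_zero, ← pow_add] at hpow
  exact (hbinom.mul (tendsto_qHomog hq d)).mul hpow

/-- The sum `S` in the asymptotic formula. -/
def limitSum (q : ℝ) (d j k : ℕ) : ℝ :=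
  ∑ r ∈ Finset.range (min j k + 1),
    (q ^ r)⁻¹ * (1 / qPoch q (j - r)) * qBinom q (d + k - r - 1) (k - r)

theorem limitSum_zero_right (hq : |q| ≠ 1) (d j : ℕ) : limitSum q d j 0 = 1 / qPoch q j := by
  simp [limitSum, qBinom_zero_right hq]

theorem limitSum_zero_left (q : ℝ) (d k : ℕ) : limitSum q d 0 k = qHomog q d k := by
  simp [limitSum, qPoch_zero, qHomog]

theorem limitSum_succ_succ (q : ℝ) (d j k : ℕ) :
    limitSum q d (j + 1) (k + 1) = limitSum q d j k / q + qHomog q d (k + 1) / qPoch q (j + 1) := by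
  rw [limitSum, Nat.add_min_add_right, Finset.sum_range_succ', limitSum, Finset.sum_div]
  congr 1
  · refine Finset.sum_congr rfl fun r _ => ?_
    rw [Nat.add_sub_add_right, Nat.add_sub_add_right, ← add_assoc d, Nat.add_sub_add_right,
      pow_succ, mul_inv]
    ring
  · simp only [qHomog, pow_zero, inv_one, Nat.sub_zero]
    ring

theorem tendsto_of_const_mul_eq {M α : Type*} [GroupWithZero M] [TopologicalSpace M]
    [ContinuousMul M] {l : Filter α} {f g : α → M} {a b c : M} (hc : c ≠ 0)
    (hfg : ∀ n, c * f n = g n) (hg : Tendsto g l (𝓝 b)) (hb : c * a = b) :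
    Tendsto f l (𝓝 a) := by
  rw [← hb] at hg
  simpa only [← hfg, inv_mul_cancel_left₀ hc] using hg.const_mul c⁻¹

theorem tendsto_hookSum (hq0 : q ≠ 0) (hq : |q| < 1) (d j k : ℕ) :
    Tendsto (hookSum q (d + 1) j k) atTop
      (𝓝 (q ^ (j + k) * (qPoch q j / qPoch q (d + k + 1)) * limitSum q (d + 1) j k)) := by
  have hpoch := qPoch_ne_zero hq.ne
  have hfactor := one_sub_pow_ne_zero hq.ne
  have hhomog : ∀ k, qHomog q (d + 1) k = qPoch q (d + k) / (qPoch q k * qPoch q d) := fun k => by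
    rw [qHomog_succ_left, qBinom_add hq.ne]
  induction j generalizing k with
  | zero =>
    refine tendsto_of_const_mul_eq (hfactor (d + k))
      (fun n => by rw [add_right_comm]; exact one_sub_pow_mul_hookSum_zero_left hq.ne (d + 1) k n)
      (tendsto_hookBoundary hq d 0 k) ?_
    have := hpoch (d + k)
    have := hfactor (d + k)
    rw [limitSum_zero_left, hhomog, qPoch_succ, qPoch_zero]
    field_simp
  | succ j ih =>
    cases k with
    | zero =>
      refine tendsto_of_const_mul_eq (hfactor d)
        (one_sub_pow_mul_hookSum_zero_right hq.ne (d + 1) (j + 1))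
        (tendsto_hookBoundary hq d (j + 1) 0) ?_
      have := hpoch (j + 1)
      have := hfactor d
      rw [limitSum_zero_right hq.ne, add_zero, add_zero, qPoch_succ q d, qPoch_zero]
      field_simp
    | succ k =>
      refine tendsto_of_const_mul_eq (hfactor (d + 1 + k))
        (one_sub_pow_mul_hookSum_succ_succ hq.ne (d + 1) j k)
        ((((tendsto_add_atTop_iff_nat 1).2 (ih k)).const_mul _).add
          (tendsto_hookBoundary hq d (j + 1) (k + 1))) ?_
      have := hpoch j
      have := hpoch (d + k + 1)
      have := hfactor (d + k + 1)
      have := hfactor j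
      rw [limitSum_succ_succ, hhomog, qPoch_succ q j, ← add_assoc d k 1,
        qPoch_succ q (d + k + 1), show d + 1 + k + 1 = d + k + 1 + 1 by ring]
      field_simp
      ring

theorem prod_qPoch_div (hq : |q| ≠ 1) (d n : ℕ) :
    ∏ b ∈ Finset.range n, qPoch q b / qPoch q (d + b) =
      ∏ i ∈ Finset.range d, qPoch q i / qPoch q (n + i) := by
  rw [Finset.prod_div_distrib, Finset.prod_div_distrib,
    div_eq_div_iff (prod_qPoch_ne_zero hq _ _) (prod_qPoch_ne_zero hq _ _),
    ← Finset.prod_range_add (qPoch q), ← Finset.prod_range_add (qPoch q), add_comm]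

theorem tendsto_prod_qPoch_div (hq : |q| < 1) (d : ℕ) :
    Tendsto (fun n => ∏ b ∈ Finset.range n, qPoch q b / qPoch q (d + b)) atTop
      (𝓝 ((∏ i ∈ Finset.range d, qPoch q i) / qPochInf q ^ d)) := by
  have hlim := tendsto_finsetProd (Finset.range d) fun i _ =>
    (tendsto_const_nhds (x := qPoch q i)).div ((tendsto_add_atTop_iff_nat i).2 (tendsto_qPoch hq))
      (qPochInf_ne_zero hq)
  rw [Finset.prod_div_distrib, Finset.prod_const, Finset.card_range] at hlim
  simpa only [prod_qPoch_div hq.ne d, Pi.div_apply] using hlim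

theorem skewSchur_rectAddRow_div (hq0 : q ≠ 0) (hq : |q| < 1) {d N j k : ℕ} (hd : 1 ≤ d)
    (hj : j ≤ N) (hk : k ≤ N) :
    skewSchur (rectAddRow d N j) (oneRow k) (fun i => q ^ i) /
        (q ^ ((d : ℤ) * j - (d - 1) * k + (d : ℤ) * (d - 1) / 2 * N) *
          ((1 - q) ^ (d * (d - 1) / 2) * qBarnes q (d + 1) / qPochInf q ^ d)) =
      qPochInf q ^ d / (∏ i ∈ Finset.range d, qPoch q i) *
        (qPoch q (d + k) / qPoch q j / q ^ (j + k)) *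
        ((∏ b ∈ Finset.range (N + 1), qPoch q b / qPoch q (d + b)) *
          hookSum q d j k (N + 1 - j)) := by
  have hq1 : 1 - q ≠ 0 := by simpa using one_sub_pow_ne_zero hq.ne 0
  have hprod := prod_qPoch_ne_zero hq.ne (Finset.range d) id
  dsimp only [id] at hprod
  have hbarnes : (1 - q) ^ (d * (d - 1) / 2) * qBarnes q (d + 1) =
      ∏ i ∈ Finset.range d, qPoch q i := by
    rw [qBarnes_succ, ← Nat.choose_two_right]
    field_simp
  have hpow : q ^ ((d : ℤ) * j - (d - 1) * k + (d.choose 2 : ℕ) * N) =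
      (q ^ d.choose 2) ^ N * ((q ^ d) ^ j * q ^ k / (q ^ d) ^ k) := by
    rw [zpow_add₀ hq0, zpow_sub₀ hq0, sub_mul, zpow_sub₀ hq0, one_mul]
    simp only [← Nat.cast_mul, zpow_natCast, pow_mul]
    field_simp
  have hinf := qPochInf_ne_zero hq
  have hpoch := qPoch_ne_zero hq.ne j
  rw [skewSchur, (hasSum_weight_rectAddRow hq0 hq hd hj hk).tsum_eq, hbarnes, mul_sub_one_ediv_two,
    hpow]
  field_simp
  ring

theorem tendsto_skewSchur_rectAddRow_div (hq0 : q ≠ 0) (hq : |q| < 1) {d : ℕ} (hd : 1 ≤ d)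
    (j k : ℕ) :
    Tendsto
      (fun N : ℕ => skewSchur (rectAddRow d N j) (oneRow k) (fun i => q ^ i) /
        (q ^ ((d : ℤ) * j - (d - 1) * k + (d : ℤ) * (d - 1) / 2 * N) *
          ((1 - q) ^ (d * (d - 1) / 2) * qBarnes q (d + 1) / qPochInf q ^ d)))
      atTop (𝓝 (limitSum q d j k)) := by
  obtain ⟨e, rfl⟩ := Nat.exists_eq_add_of_le' hd
  have hprod := prod_qPoch_ne_zero hq.ne (Finset.range (e + 1)) id
  have hinf := qPochInf_ne_zero hq
  have hj := qPoch_ne_zero hq.ne j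
  have hk := qPoch_ne_zero hq.ne (e + 1 + k)
  dsimp only [id] at hprod
  have hlim := (((tendsto_add_atTop_iff_nat 1).2 (tendsto_prod_qPoch_div hq (e + 1))).mul
    ((tendsto_hookSum hq0 hq e j k).comp
      ((tendsto_sub_atTop_nat j).comp (tendsto_add_atTop_nat 1)))).const_mul
    (qPochInf q ^ (e + 1) / (∏ i ∈ Finset.range (e + 1), qPoch q i) *
      (qPoch q (e + 1 + k) / qPoch q j / q ^ (j + k)))
  convert hlim.congr' ?_ using 2
  · rw [add_right_comm e k 1]
    field_simp
  · filter_upwards [eventually_ge_atTop j, eventually_ge_atTop k] with N hjN hkN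
    exact (skewSchur_rectAddRow_div hq0 hq hd hjN hkN).symm

theorem qPoch_pos (hq : |q| < 1) (n : ℕ) : 0 < qPoch q n := by
  refine Finset.prod_pos fun i hi => sub_pos.2 ((le_abs_self _).trans_lt ?_)
  rw [abs_pow]
  exact pow_lt_one₀ (abs_nonneg q) hq (Nat.one_le_iff_ne_zero.1 (Finset.mem_Icc.1 hi).1)

theorem limitSum_pos (hq0 : 0 < q) (hq : |q| < 1) {d : ℕ} (hd : 1 ≤ d) (j k : ℕ) :
    0 < limitSum q d j k := by
  refine Finset.sum_pos (fun r hr => ?_) ⟨0, by simp⟩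
  have hr := Finset.mem_range.1 hr
  rw [show d + k - r - 1 = d - 1 + (k - r) by omega, qBinom_add hq.ne]
  have := qPoch_pos hq (j - r)
  have := qPoch_pos hq (d - 1 + (k - r))
  have := qPoch_pos hq (k - r)
  have := qPoch_pos hq (d - 1)
  positivity

end Asymptotic

end

theorem mainTheorem9 (q : ℝ) (hq0 : q ≠ 0) (hq1 : |q| < 1) (d j k : ℕ) (hd : 1 ≤ d) :
    (∀ N : ℕ, j ≤ N → k ≤ N →
      Summable (fun T : SkewTableau (rectAddRow d N j) (oneRow k) => T.weight (fun i => q ^ i)) ∧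
      skewSchur (rectAddRow d N j) (oneRow k) (fun i => q ^ i) =
        q ^ (((d : ℤ) - 1) * j - d * k + (d : ℤ) * (d - 1) / 2 * N) / (1 - q) ^ (d * (N + 1)) *
          (qBarnes q (N + 2) * qBarnes q (d + 1) / qBarnes q (d + N + 2)) *
          (qPoch q (d + k) / qPoch q j) *
          ∑ r ∈ Finset.Icc (max j k) N,
            q ^ r * qBinom q r (r - k) * qBinom q (d + r - j - 1) (r - j)) ∧
    Tendsto
      (fun N : ℕ => skewSchur (rectAddRow d N j) (oneRow k) (fun i => q ^ i) /
        (q ^ ((d : ℤ) * j - (d - 1) * k + (d : ℤ) * (d - 1) / 2 * N) *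
          ((1 - q) ^ (d * (d - 1) / 2) * qBarnes q (d + 1) / qPochInf q ^ d)))
      atTop
      (𝓝 (∑ r ∈ Finset.range (min j k + 1),
        (q ^ r)⁻¹ * (1 / qPoch q (j - r)) * qBinom q (d + k - r - 1) (k - r))) ∧
    (0 < q →
      (fun N : ℕ => skewSchur (rectAddRow d N j) (oneRow k) (fun i => q ^ i)) ~[atTop]
      (fun N : ℕ =>
        q ^ ((d : ℤ) * j - (d - 1) * k + (d : ℤ) * (d - 1) / 2 * N) *
          ((1 - q) ^ (d * (d - 1) / 2) * qBarnes q (d + 1) / qPochInf q ^ d) *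
          ∑ r ∈ Finset.range (min j k + 1),
            (q ^ r)⁻¹ * (1 / qPoch q (j - r)) * qBinom q (d + k - r - 1) (k - r))) := by
  have hlim := tendsto_skewSchur_rectAddRow_div hq0 hq1 hd j k
  refine ⟨fun N hj hk => ?_, hlim, fun hq => ?_⟩
  · have h := hasSum_weight_rectAddRow_closed_form hq0 hq1 hd hj hk
    exact ⟨h.summable, h.tsum_eq⟩
  · have hS := limitSum_pos hq hq1 hd j k
    refine isEquivalent_of_tendsto_one ?_
    have h := hlim.div_const (limitSum q d j k)
    rw [div_self hS.ne'] at h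
    refine h.congr fun N => ?_
    rw [div_div]
    rfl
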